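/- Notation. $\mathbb N=\{1,2,\dots\}$, and $\log$ is the logarithm to base $2$. Let $L^\infty([0,1])$ be the space of bounded functions $f:[0,1]\to\mathbb R$ with the norm $\|f\|=\sup_{x\in[0,1]}|f(x)|$, and let $\mathrm{Lip}([0,1])$ be the set of continuous $f:[0,1]\to\mathbb R$ with $|f(x)|\le 1$ and $|f(x)-f(y)|\le|x-y|$ for all $x,y\in[0,1]$. A network configuration of depth $\ell\ge 1$ with one input and one output is a sequence $\Phi=((A_i,b_i))_{i=1}^{\ell}$ with $A_i\in\mathbb R^{N_i\times N_{i-1}}$, $b_i\in\mathbb R^{N_i}$, $N_0,\dots,N_\ell\in\mathbb N$, $N_0=N_\ell=1$; its width is $\max_{0\le i\le \ell}N_i$, and its weights are the entries of all $A_i$ and $b_i$. With $S(A,b)(x)=Ax+b$ and $\rho(x)=\max\{x,0\}$ (entrywise), its realization is $S(A_\ell,b_\ell)\circ\rho\circ S(A_{\ell-1},b_{\ell-1})\circ\cdots\circ\rho\circ S(A_1,b_1)$. For $W,L,b\in\mathbb N$, let $\mathcal R^1_b(W,L)$ be the set of realizations, regarded as functions on $[0,1]$, of all such configurations with width at most $W$,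 depth at most $L$ and all weights in $(-4,4)\cap 2^{-b}\mathbb Z$. For a metric space $(\mathcal X,\delta)$ and $\mathcal Y,\mathcal G\subseteq\mathcal X$, put $\mathcal A(\mathcal Y,\mathcal G,\delta)=\sup_{f\in\mathcal Y}\inf_{g\in\mathcal G}\delta(f,g)$. For $\varepsilon\ge 0$, let $\ell(\varepsilon,\mathcal Y)$ be the least integer $\ell\ge 0$ for which there are maps $E:\mathcal Y\to\{0,1\}^\ell$ and $D:\{0,1\}^\ell\to\mathcal X$ with $\sup_{y\in\mathcal Y}\delta(y,D(E(y)))\le\varepsilon$. A family $\{\mathcal G_i\}_{i\in\mathcal I}$ of finite subsets of $\mathcal X$ achieves memory optimality in the approximation of $\mathcal Y$ if $$\inf_{i\in\mathcal I}\mathcal A(\mathcal Y,\mathcal G_i,\delta)=0\quad\text{and}\quad \sup_{i\in\mathcal I}\frac{\lceil\log|\mathcal G_i|\rceil}{1+\ell(\mathcal A(\mathcal Y,\mathcal G_i,\delta),\mathcal Y)}<\infty .$$ Write $\mathcal A_\infty$ for $\mathcal A$ when $\mathcal X=L^\infty([0,1])$ and $\delta$ is the metric of its norm. Proposition. There exist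 absolute constants $C_1,D_1,E_1>0$ with $D_1\ge 2$ such that for all $W,L\in\mathbb N$ with $W,L\ge D_1$, $$\mathcal A_\infty\bigl(\mathrm{Lip}([0,1]),\mathcal R^1_{\lceil E_1L\log W\rceil}(W,L)\bigr)\le C_1\,(W^2L^2\log W)^{-1},$$ and the family $\{\mathcal R^1_{\lceil E_1L\log W\rceil}(W,L): W,L\in\mathbb N,\ W,L\ge D_1\}$ of subsets of $L^\infty([0,1])$ achieves memory optimality in the approximation of $\mathrm{Lip}([0,1])$. -/

import Mathlib

open scoped ENNReal

noncomputable section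

namespace ReLUNet

/-! ### Metric notions: minimax error, minimax code length, memory redundancy -/

section Metric

variable {X : Type*} [MetricSpace X]

/-- Minimax error `sup_{f ∈ F} inf_{g ∈ G} δ(f, g)`, as an extended nonnegative real
(so that no supremum or infimum takes a default value). -/
def minimaxError (F G : Set X) : ℝ≥0∞ :=
  ⨆ f ∈ F, ⨅ g ∈ G, edist f g

/-- `E : Y → {0,1}^ℓ` and `D : {0,1}^ℓ → X` form an encoder-decoder pair of length `ℓ`
with uniform error at most `ε` over `Y`. -/
def HasUniformError (ε : ℝ≥0∞) (Y : Set X) (ℓ : ℕ)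
    (E : Y → (Fin ℓ → Bool)) (D : (Fin ℓ → Bool) → X) : Prop :=
  ⨆ y : Y, edist (y : X) (D (E y)) ≤ ε

/-- Minimax code length: the least `ℓ` for which there is an encoder-decoder pair of length `ℓ`
with uniform error at most `ε` over `Y` (`⊤` if there is none). -/
def minimaxCodeLength (ε : ℝ≥0∞) (Y : Set X) : ℕ∞ :=
  ⨅ (ℓ : ℕ) (_ : ∃ (E : Y → (Fin ℓ → Bool)) (D : (Fin ℓ → Bool) → X),
    HasUniformError ε Y ℓ E D), (ℓ : ℕ∞)

/-- Memory redundancy `⌈log₂ |G|⌉ / (1 + ℓ(A(Y, G), Y))` of a finite set `G` in the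
approximation of `Y`. -/
def memoryRedundancy (Y G : Set X) : ℝ≥0∞ :=
  (⌈Real.logb 2 (G.ncard : ℝ)⌉₊ : ℝ≥0∞) /
    (1 + (minimaxCodeLength (minimaxError Y G) Y : ℝ≥0∞))

/-- A family `G` of finite subsets of `X` achieves memory optimality in the approximation
of `Y`: the minimax error gets arbitrarily small while the memory redundancy stays bounded. -/
structure AchievesMemoryOptimality {ι : Type*} (Y : Set X) (G : ι → Set X) : Prop where
  finite : ∀ i, (G i).Finite
  inf_error : ⨅ i, minimaxError Y (G i) = 0
  sup_redundancy : ⨆ i, memoryRedundancy Y (G i) < ⊤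

end Metric

/-! ### ReLU networks -/

/-- Network configurations `((A_i, b_i))_{i = 1}^L`, `L ≥ 1`, with input dimension `d`, output
dimension `d'` and positive layer widths: either a single layer (`L = 1`), or a configuration
of depth `L - 1` followed by a last layer `(A_L, b_L)`. -/
inductive Config (d : ℕ) : ℕ → Type
  | single {d' : ℕ} (hd : 0 < d) (hd' : 0 < d')
      (A : Matrix (Fin d') (Fin d) ℝ) (b : Fin d' → ℝ) : Config d d'
  | snoc {n d' : ℕ} (Φ : Config d n) (hd' : 0 < d')
      (A : Matrix (Fin d') (Fin n) ℝ) (b : Fin d' → ℝ) : Config d d'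

namespace Config

/-- Number of layers. -/
def depth {d : ℕ} : {d' : ℕ} → Config d d' → ℕ
  | _, single _ _ _ _ => 1
  | _, snoc Φ _ _ _ => Φ.depth + 1

/-- Maximum of the layer widths `N_0, …, N_L` (input and output included). -/
def width {d : ℕ} : {d' : ℕ} → Config d d' → ℕ
  | d', single _ _ _ _ => max d d'
  | d', snoc Φ _ _ _ => max Φ.width d'

/-- The set of all entries of the matrices `A_i` and the vectors `b_i`. -/
def weights {d : ℕ} : {d' : ℕ} → Config d d' → Set ℝ
  | _, single _ _ A b => (Set.range fun p : _ × _ => A p.1 p.2) ∪ Set.range b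
  | _, snoc Φ _ A b =>
      Φ.weights ∪ ((Set.range fun p : _ × _ => A p.1 p.2) ∪ Set.range b)

/-- The realization `R(Φ) : ℝ^d → ℝ^{d'}`: `R(Φ) = S(A_1, b_1)` for depth one, and otherwise
`R(Φ) = S(A_L, b_L) ∘ ρ ∘ R((A_i, b_i)_{i < L})`, where `S(A, b) x = A x + b` and
`ρ = max(·, 0)` acts entrywise. -/
def realize {d : ℕ} : {d' : ℕ} → Config d d' → (Fin d → ℝ) → (Fin d' → ℝ)
  | _, single _ _ A b => fun x => A.mulVec x + b
  | _, snoc Φ _ A b => fun x => A.mulVec (fun i => max (Φ.realize x i) 0) + b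

theorem continuous_realize {d d' : ℕ} (Φ : Config d d') : Continuous Φ.realize := by
  induction Φ with
  | single hd hd' A b =>
      simp only [realize]
      exact ((continuous_const (y := A)).matrix_mulVec continuous_id).add continuous_const
  | snoc Φ hd' A b ih =>
      simp only [realize]
      refine ((continuous_const (y := A)).matrix_mulVec ?_).add continuous_const
      exact continuous_pi fun i => ((continuous_apply i).comp ih).max continuous_const

end Config

/-- The space of bounded real functions on `[0,1]` with the norm `sup_{x ∈ [0,1]} |f x|`. -/
abbrev LInfty : Type := lp (fun _ : Set.Icc (0 : ℝ) 1 => ℝ) ∞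

namespace Config

theorem memℓp_realize (Φ : Config 1 1) :
    Memℓp (fun x : Set.Icc (0 : ℝ) 1 => Φ.realize (fun _ => (x : ℝ)) 0) ∞ := by
  apply memℓp_infty
  have h : Continuous fun x : Set.Icc (0 : ℝ) 1 => ‖Φ.realize (fun _ => (x : ℝ)) 0‖ :=
    ((continuous_apply 0).comp (Φ.continuous_realize.comp
      (continuous_pi fun _ => continuous_subtype_val))).norm
  exact (isCompact_range h).bddAbove

/-- The realization of a network with one input and one output, as a function on `[0,1]`. -/
def toLInfty (Φ : Config 1 1) : LInfty :=
  ⟨fun x => Φ.realize (fun _ => (x : ℝ)) 0, Φ.memℓp_realize⟩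

end Config

/-- Configurations of width at most `W` and depth at most `L` with all weights in `𝔸`. -/
def configs (𝔸 : Set ℝ) (d d' W L : ℕ) : Set (Config d d') :=
  {Φ | Φ.width ≤ W ∧ Φ.depth ≤ L ∧ Φ.weights ⊆ 𝔸}

/-- The quantized numbers `(-2^{a+1}, 2^{a+1}) ∩ 2^{-b} ℤ`. -/
def quantized (a b : ℕ) : Set ℝ :=
  Set.Ioo (-(2 : ℝ) ^ (a + 1)) ((2 : ℝ) ^ (a + 1)) ∩
    Set.range fun k : ℤ => (k : ℝ) / (2 : ℝ) ^ b

/-- The functions on `[0,1]` realized by networks with one input and one output, of width at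
most `W` and depth at most `L`, with weights in `quantized a b`. -/
def quantizedRealizations (a b W L : ℕ) : Set LInfty :=
  Config.toLInfty '' configs (quantized a b) 1 1 W L

/-- The continuous functions on `[0,1]` that are bounded by `1` and `1`-Lipschitz. -/
def lipUnit : Set LInfty :=
  {f | Continuous (f : Set.Icc (0 : ℝ) 1 → ℝ) ∧ (∀ x, |f x| ≤ 1) ∧
    ∀ x y : Set.Icc (0 : ℝ) 1, |f x - f y| ≤ |(x : ℝ) - (y : ℝ)|}

end ReLUNet

end

/-! Upper bound by bit extraction. For a 1-Lipschitz `F` with `|F| ≤ 1`, the function `H(z) = (F(2z)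
+ 1 + 2z)/4` is monotone, 1-Lipschitz and has values in `[0,1]` on `[0,1]`. Rounded on a mesh of `K`
cells it becomes an integer sequence `G` whose increments are 0 or 1, so that one bit per cell
describes it. Take `N = 2^w` of order `W`, `R` of order `L`, `m` of order `log W` with `2^m ≤ N`,
and `K = N²R²m`. A cell index splits as `k = ((pN + q)R + r)B + c` with `p, q < N`, `r < R`, `c < B
= mR`. Two tables indexed by `(r, p, q)` store `G` at the start of each block of `B` cells and the
`B` increments of the block, packed into one real number of `R` digits with `m` bits each. Width of
order `N` reads an `N × N` table in constant depth, hence both tables in depth of order `R`. Then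
`R` rounds peel off one digit each and add up its first few bits, which gives `G(k)`
(`reach_goodSample`).

A continuous network cannot compute integer parts near their jumps, so this works only in the first
three quarters of each cell. Three copies run on inputs shifted by multiples of a quarter cell; at
least two are then correct, and their median is accurate for every input (`exists_config_approx`).

All weights are kept in `[-1,1]` by carrying every activation with a common factor `2^{-s'}`, where
`s'` is of order `Rw`. This factor is removed at the end by summing `2^w` equal copies in each of
order `R` layers (`Realizes.amplify`), so a precision of order `L log W` bits suffices.

Optimality. Put `Z = W²L² log W`. Counting weights gives `log |G| ≤ 18 Z` for the network class.
Truncated distance functions form `2^n` Lipschitz functions that are `1/n`-separated, so error `C/Z`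
forces a code length of order `Z` (`le_minimaxCodeLength`). The quotient is bounded. -/

noncomputable section

namespace ReLUNet

/-! ### Dyadic grids -/

/-- The dyadic grid `2^{-g} ℤ`. -/
def grid (g : ℕ) : AddSubgroup ℝ := AddSubgroup.zmultiples ((2 : ℝ) ^ g)⁻¹

theorem mem_grid {g : ℕ} {r : ℝ} : r ∈ grid g ↔ ∃ z : ℤ, r = z / (2 : ℝ) ^ g := by
  simp only [grid, AddSubgroup.mem_zmultiples_iff, zsmul_eq_mul, div_eq_mul_inv, eq_comm]

theorem mul_mem_grid {g h : ℕ} {r s : ℝ} (hr : r ∈ grid g) (hs : s ∈ grid h) :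
    r * s ∈ grid (g + h) := by
  obtain ⟨y, rfl⟩ := mem_grid.1 hr
  obtain ⟨z, rfl⟩ := mem_grid.1 hs
  exact mem_grid.2 ⟨y * z, by push_cast; rw [pow_add, div_mul_div_comm]⟩

theorem intCast_mem_grid (g : ℕ) (z : ℤ) : (z : ℝ) ∈ grid g :=
  mem_grid.2 ⟨z * 2 ^ g, by push_cast; field_simp⟩

theorem natCast_mem_grid (g n : ℕ) : (n : ℝ) ∈ grid g := by
  exact_mod_cast intCast_mem_grid g n

theorem one_mem_grid (g : ℕ) : (1 : ℝ) ∈ grid g := by exact_mod_cast natCast_mem_grid g 1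

theorem grid_mono {g h : ℕ} (hgh : g ≤ h) {r : ℝ} (hr : r ∈ grid g) : r ∈ grid h := by
  obtain ⟨k, rfl⟩ := Nat.exists_eq_add_of_le hgh
  simpa using mul_mem_grid hr (one_mem_grid k)

theorem two_pow_inv_mem_grid (g : ℕ) : ((2 : ℝ) ^ g)⁻¹ ∈ grid g :=
  mem_grid.2 ⟨1, by simp⟩

theorem div_two_pow_mem_grid {g : ℕ} {r : ℝ} (hr : r ∈ grid g) (s : ℕ) :
    r / 2 ^ s ∈ grid (g + s) :=
  mul_mem_grid hr (two_pow_inv_mem_grid s)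

/-- The points of `2^{-b} ℤ` in `[-1, 1]`. -/
def unitGrid (b : ℕ) : Set ℝ := {r | |r| ≤ 1 ∧ r ∈ grid b}

theorem unitGrid_mono {b c : ℕ} (h : b ≤ c) : unitGrid b ⊆ unitGrid c :=
  fun _ hr => ⟨hr.1, grid_mono h hr.2⟩

theorem zero_mem_unitGrid (b : ℕ) : (0 : ℝ) ∈ unitGrid b := ⟨by simp, zero_mem _⟩

theorem one_mem_unitGrid (b : ℕ) : (1 : ℝ) ∈ unitGrid b := ⟨by simp, one_mem_grid b⟩

theorem neg_mem_unitGrid {b : ℕ} {r : ℝ} (hr : r ∈ unitGrid b) : -r ∈ unitGrid b :=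
  ⟨by simpa using hr.1, neg_mem hr.2⟩

theorem unitGrid_subset_quantized (b : ℕ) : unitGrid b ⊆ quantized 1 b := by
  rintro r ⟨h1, h2⟩
  obtain ⟨z, rfl⟩ := mem_grid.1 h2
  have := abs_le.1 h1
  exact ⟨⟨by norm_num; linarith, by norm_num; linarith⟩, z, rfl⟩

/-! ### Networks on a family of samples -/

variable {α ι κ : Type}

/-- Some network with at most `k` layers, width at most `W` and weights in `unitGrid b` has, on
the input `inp a`, the vector `u a` of activations after the ReLU of its last layer. -/
def Realizes (b W k : ℕ) (inp : α → ℝ) (u : α → ι → ℝ) : Prop :=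
  ∃ (n : ℕ) (e : ι ≃ Fin n) (Φ : Config 1 n), Φ.depth ≤ k ∧ Φ.width ≤ W ∧
    Φ.weights ⊆ unitGrid b ∧ ∀ a i, max (Φ.realize (fun _ => inp a) (e i)) 0 = u a i

theorem Realizes.congr {b W k : ℕ} {inp : α → ℝ} {u u' : α → ι → ℝ}
    (h : Realizes b W k inp u) (huu : ∀ a i, u a i = u' a i) : Realizes b W k inp u' := by
  obtain ⟨n, e, Φ, h1, h2, h3, h4⟩ := h
  exact ⟨n, e, Φ, h1, h2, h3, fun a i => (h4 a i).trans (huu a i)⟩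

theorem Realizes.input [Fintype κ] [Nonempty κ] (b W : ℕ) (inp : α → ℝ) (A c : κ → ℝ)
    (hA : ∀ j, A j ∈ unitGrid b) (hc : ∀ j, c j ∈ unitGrid b) (hW : Fintype.card κ ≤ W) :
    Realizes b W 1 inp fun a j => max (A j * inp a + c j) 0 := by
  let e := Fintype.equivFin κ
  refine ⟨_, e, .single one_pos Fintype.card_pos (fun j _ => A (e.symm j))
    (fun j => c (e.symm j)), le_rfl, ?_, ?_, ?_⟩
  · exact max_le (Fintype.card_pos.trans_le hW) hW
  · rintro _ (⟨p, rfl⟩ | ⟨j, rfl⟩)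
    exacts [hA _, hc _]
  · intro a i
    simp [Config.realize, Matrix.mulVec, dotProduct]

theorem Realizes.layer [Fintype ι] [Fintype κ] [Nonempty κ] {b b' W k : ℕ} {inp : α → ℝ}
    {u : α → ι → ℝ}
    (h : Realizes b W k inp u) (hb : b ≤ b') (A : κ → ι → ℝ) (c : κ → ℝ)
    (hA : ∀ j i, A j i ∈ unitGrid b') (hc : ∀ j, c j ∈ unitGrid b')
    (hW : Fintype.card κ ≤ W) :
    Realizes b' W (k + 1) inp fun a j => max (∑ i, A j i * u a i + c j) 0 := by
  obtain ⟨n, e, Φ, h1, h2, h3, h4⟩ := h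
  let e' := Fintype.equivFin κ
  refine ⟨_, e', .snoc Φ Fintype.card_pos (fun j i => A (e'.symm j) (e.symm i))
    (fun j => c (e'.symm j)), Nat.succ_le_succ h1, max_le h2 hW, ?_, ?_⟩
  · rintro _ (hr | ⟨p, rfl⟩ | ⟨j, rfl⟩)
    exacts [unitGrid_mono hb (h3 hr), hA _ _, hc _]
  · intro a i
    have := e.sum_comp fun x => A i (e.symm x) * max (Φ.realize (fun _ => inp a) x) 0
    simp only [Equiv.symm_apply_apply, h4] at this
    simp [Config.realize, Matrix.mulVec, dotProduct, this]

/-! ### Affine combinations of channels -/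

section Channels

variable [Fintype ι]

/-- `f` is an affine combination of the channels of `v` with coefficients in
`2^{-g} ℤ ∩ [-M, M]`. -/
def Aff (g : ℕ) (M : ℝ) (v : α → ι → ℝ) (f : α → ℝ) : Prop :=
  ∃ (A : ι → ℝ) (c : ℝ), (∀ i, |A i| ≤ M ∧ A i ∈ grid g) ∧ |c| ≤ M ∧ c ∈ grid g ∧
    ∀ a, f a = ∑ i, A i * v a i + c

namespace Aff

variable {g : ℕ} {M M' : ℝ} {v : α → ι → ℝ} {f f' : α → ℝ}

theorem mono (h : Aff g M v f) (hM : M ≤ M') : Aff g M' v f := by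
  obtain ⟨A, c, h1, h2, h3, h4⟩ := h
  exact ⟨A, c, fun i => ⟨(h1 i).1.trans hM, (h1 i).2⟩, h2.trans hM, h3, h4⟩

theorem congr (h : Aff g M v f) (hf : ∀ a, f a = f' a) : Aff g M v f' := by
  obtain rfl : f = f' := funext hf
  exact h

theorem of_zero (h : Aff 0 M v f) : Aff g M v f := by
  obtain ⟨A, c, h1, h2, h3, h4⟩ := h
  exact ⟨A, c, fun i => ⟨(h1 i).1, grid_mono (Nat.zero_le g) (h1 i).2⟩, h2,
    grid_mono (Nat.zero_le g) h3, h4⟩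

theorem coord (i : ι) : Aff g 1 v fun a => v a i := by
  classical
  refine ⟨fun j => if j = i then 1 else 0, 0, fun j => ?_, by simp, zero_mem _, by simp⟩
  dsimp only
  split_ifs <;> simp [one_mem_grid, zero_mem]

theorem const {r : ℝ} (hr : r ∈ grid g) : Aff g |r| v fun _ => r :=
  ⟨fun _ => 0, r, fun j => by simp [zero_mem], le_rfl, hr, by simp⟩

theorem natCast (n : ℕ) : Aff g n v fun _ => (n : ℝ) := by
  simpa using const (g := g) (v := v) (natCast_mem_grid g n)

theorem one : Aff g 1 v fun _ => (1 : ℝ) := by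
  simpa using const (g := g) (v := v) (one_mem_grid g)

theorem add (h : Aff g M v f) (h' : Aff g M' v f') : Aff g (M + M') v fun a => f a + f' a := by
  obtain ⟨A, c, h1, h2, h3, h4⟩ := h
  obtain ⟨A', c', h1', h2', h3', h4'⟩ := h'
  refine ⟨fun i => A i + A' i, c + c', fun i => ⟨?_, add_mem (h1 i).2 (h1' i).2⟩,
    (abs_add_le _ _).trans (add_le_add h2 h2'), add_mem h3 h3', fun a => ?_⟩
  · exact (abs_add_le _ _).trans (add_le_add (h1 i).1 (h1' i).1)
  · simp only [h4, h4']
    simp only [add_mul, Finset.sum_add_distrib]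
    ring

theorem neg (h : Aff g M v f) : Aff g M v fun a => -f a := by
  obtain ⟨A, c, h1, h2, h3, h4⟩ := h
  refine ⟨fun i => -A i, -c, fun i => ⟨by simpa using (h1 i).1, neg_mem (h1 i).2⟩,
    by simpa using h2, neg_mem h3, fun a => ?_⟩
  simp only [h4]
  simp only [neg_mul, Finset.sum_neg_distrib]
  ring

theorem sub (h : Aff g M v f) (h' : Aff g M' v f') : Aff g (M + M') v fun a => f a - f' a := by
  simpa only [sub_eq_add_neg] using h.add h'.neg

theorem grid_mul (h : Aff 0 M v f) {r : ℝ} (hr : r ∈ grid g) :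
    Aff g (|r| * M) v fun a => r * f a := by
  obtain ⟨A, c, h1, h2, h3, h4⟩ := h
  refine ⟨fun i => r * A i, r * c, fun i => ⟨?_, mul_mem_grid hr (h1 i).2⟩, ?_,
    mul_mem_grid hr h3, fun a => ?_⟩
  · rw [abs_mul]; exact mul_le_mul_of_nonneg_left (h1 i).1 (abs_nonneg r)
  · rw [abs_mul]; exact mul_le_mul_of_nonneg_left h2 (abs_nonneg r)
  · simp only [h4, mul_add, Finset.mul_sum, mul_assoc]

theorem natCast_mul (h : Aff g M v f) (n : ℕ) : Aff g (n * M) v fun a => n * f a := by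
  obtain ⟨A, c, h1, h2, h3, h4⟩ := h
  have hn (r : ℝ) (hr : r ∈ grid g) : (n : ℝ) * r ∈ grid g := by
    simpa using mul_mem_grid (natCast_mem_grid 0 n) hr
  refine ⟨fun i => n * A i, n * c, fun i => ⟨?_, hn _ (h1 i).2⟩, ?_, hn _ h3, fun a => ?_⟩
  · rw [abs_mul, Nat.abs_cast]; exact mul_le_mul_of_nonneg_left (h1 i).1 n.cast_nonneg
  · rw [abs_mul, Nat.abs_cast]; exact mul_le_mul_of_nonneg_left h2 n.cast_nonneg
  · simp only [h4, mul_add, Finset.mul_sum, mul_assoc]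

theorem sum {σ : Type} (s : Finset σ) {f : σ → α → ℝ} (h : ∀ j ∈ s, Aff g M v (f j)) :
    Aff g (s.card * M) v fun a => ∑ j ∈ s, f j a := by
  classical
  induction s using Finset.induction_on with
  | empty => simpa using const (g := g) (v := v) (zero_mem _)
  | insert j s hj ih =>
    simp only [Finset.sum_insert hj, Finset.card_insert_of_notMem hj]
    refine ((h j (Finset.mem_insert_self j s)).add
      (ih fun i hi => h i (Finset.mem_insert_of_mem hi))).mono (le_of_eq ?_)
    push_cast; ring

end Aff

/-- `f` is the ReLU of an affine combination of the channels of `v`. -/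
def IsNeuron (g : ℕ) (M : ℝ) (v : α → ι → ℝ) (f : α → ℝ) : Prop :=
  ∃ f', Aff g M v f' ∧ ∀ a, f a = max (f' a) 0

namespace IsNeuron

variable {g : ℕ} {M M' : ℝ} {v : α → ι → ℝ} {f : α → ℝ}

theorem relu (h : Aff g M v f) (hM : M ≤ M') : IsNeuron g M' v fun a => max (f a) 0 :=
  ⟨f, h.mono hM, fun _ => rfl⟩

/-- The ReLU fixes nonnegative quantities; this is how channels are carried unchanged from layer to
layer. -/
theorem of_nonneg (h : Aff g M v f) (hM : M ≤ M') (h0 : ∀ a, 0 ≤ f a) : IsNeuron g M' v f :=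
  ⟨f, h.mono hM, fun a => (max_eq_left (h0 a)).symm⟩

theorem zero (hM : 0 ≤ M) : IsNeuron g M v fun _ => 0 :=
  .of_nonneg (.const (zero_mem _)) (by simpa using hM) fun _ => le_rfl

end IsNeuron

end Channels

/-! ### Rescaled networks -/

/-- The vector `v` of channels is computed, up to a factor `2^{-s'}` with `s' ≤ s`, by a network
with at most `k` layers, width at most `W` and weights in `unitGrid (g + s')`. -/
def Reach (g W k s : ℕ) (inp : α → ℝ) (v : α → ι → ℝ) : Prop :=
  ∃ s' ≤ s, Realizes (g + s') W k inp fun a i => v a i / 2 ^ s'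

/-- The channels of `v` together with a further channel `f`. -/
def ext (v : α → ι → ℝ) (f : α → ℝ) : α → Option ι → ℝ := fun a o => o.elim (f a) (v a)

@[simp] theorem ext_none (v : α → ι → ℝ) (f : α → ℝ) (a : α) : ext v f a none = f a := rfl

@[simp] theorem ext_some (v : α → ι → ℝ) (f : α → ℝ) (a : α) (i : ι) :
    ext v f a (some i) = v a i := rfl

namespace Reach

variable {g W k s t : ℕ} {inp : α → ℝ} {v : α → ι → ℝ}

theorem mono {k' s' : ℕ} (h : Reach g W k s inp v) (hk : k ≤ k') (hs : s ≤ s') :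
    Reach g W k' s' inp v := by
  obtain ⟨r, hr, n, e, Φ, h1, h2⟩ := h
  exact ⟨r, hr.trans hs, n, e, Φ, h1.trans hk, h2⟩

theorem congr {v' : α → ι → ℝ} (h : Reach g W k s inp v) (hv : ∀ a i, v a i = v' a i) :
    Reach g W k s inp v' := by
  obtain rfl : v = v' := by ext a i; exact hv a i
  exact h

theorem nonneg (h : Reach g W k s inp v) (a : α) (i : ι) : 0 ≤ v a i := by
  obtain ⟨r, _, n, e, Φ, _, _, _, h4⟩ := h
  have : 0 ≤ v a i / 2 ^ r := (le_max_right _ _).trans_eq (h4 a i)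
  by_contra! hneg
  exact absurd this (not_le.2 (div_neg_of_neg_of_pos hneg (by positivity)))

/-- The ReLU is positively homogeneous, so coefficients up to `2^t` can be divided by `2^t` at the
price of `t` further bits of scale. Biases carry the whole accumulated factor `2^{r+t}`, whence the
precision `g + (r + t)`. -/
theorem layer [Fintype ι] [Fintype κ] [Nonempty κ] (h : Reach g W k s inp v) (t : ℕ) (w : α → κ → ℝ)
    (hW : Fintype.card κ ≤ W) (hw : ∀ j, IsNeuron g (2 ^ t) v fun a => w a j) :
    Reach g W (k + 1) (s + t) inp w := by
  obtain ⟨r, hr, hR⟩ := h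
  choose f hf hwf using hw
  choose A c hA hc hcg hfA using hf
  refine ⟨r + t, by omega, (hR.layer (b' := g + (r + t)) (by omega)
    (fun j i => A j i / 2 ^ t) (fun j => c j / 2 ^ (r + t)) (fun j i => ⟨?_, ?_⟩)
    (fun j => ⟨?_, div_two_pow_mem_grid (hcg j) _⟩) hW).congr fun a j => ?_⟩
  · rw [abs_div, abs_of_pos (by positivity : (0 : ℝ) < 2 ^ t)]
    exact div_le_one_of_le₀ (hA j i).1 (by positivity)
  · exact grid_mono (by omega) (div_two_pow_mem_grid (hA j i).2 t)
  · rw [abs_div, abs_of_pos (by positivity : (0 : ℝ) < 2 ^ (r + t))]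
    refine div_le_one_of_le₀ ((hc j).trans ?_) (by positivity)
    exact pow_le_pow_right₀ one_le_two (by omega)
  · rw [show w a j = max (f j a) 0 from hwf j a, hfA,
      ← max_div_div_right (by positivity : (0 : ℝ) ≤ 2 ^ (r + t)), zero_div, add_div,
      Finset.sum_div]
    congr 2
    refine Finset.sum_congr rfl fun i _ => ?_
    rw [div_mul_div_comm, pow_add, mul_comm ((2 : ℝ) ^ t)]

theorem append [Fintype ι] (h : Reach g W k s inp v) (t : ℕ) {f : α → ℝ}
    (hf : IsNeuron g (2 ^ t) v f)
    (hW : Fintype.card ι + 1 ≤ W) : Reach g W (k + 1) (s + t) inp (ext v f) := by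
  refine h.layer t _ (by simpa using hW) ?_
  rintro (_ | i)
  · exact hf
  · exact .of_nonneg (.coord i) (one_le_pow₀ one_le_two) fun a => h.nonneg a i

end Reach

/-! ### Computing integer parts -/

/-- Each difference of ramps is a step that rises from 0 to `δ` on `[j + 1 - δ, j + 1]`. The gap
hypothesis keeps `y` out of the interior of these intervals, so the sum counts the integers `1, …,
n` below `y`. -/
theorem sum_ramp_eq_min_floor {y δ : ℝ} (hδ : 0 ≤ δ) (hy : 0 ≤ y)
    (hgap : y ≤ ⌊y⌋₊ + 1 - δ) (n : ℕ) :
    ∑ j ∈ Finset.range n, (max (y - (j + 1 : ℕ) + δ) 0 - max (y - (j + 1 : ℕ)) 0) =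
      (min ⌊y⌋₊ n : ℕ) * δ := by
  induction n with
  | zero => simp
  | succ n ih =>
    rw [Finset.sum_range_succ, ih]
    have hfl := Nat.floor_le hy
    rcases lt_or_ge n ⌊y⌋₊ with hn | hn
    · have : ((n + 1 : ℕ) : ℝ) ≤ ⌊y⌋₊ := by exact_mod_cast hn
      rw [min_eq_right hn.le, min_eq_right (by omega), max_eq_left (by linarith),
        max_eq_left (by linarith)]
      push_cast; ring
    · have : ((⌊y⌋₊ : ℕ) : ℝ) + 1 ≤ (n + 1 : ℕ) := by exact_mod_cast Nat.succ_le_succ hn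
      rw [min_eq_left hn, min_eq_left (by omega), max_eq_right (by linarith),
        max_eq_right (by linarith)]
      ring

theorem floor_max_sub_natCast (y : ℝ) (n : ℕ) : ⌊max (y - n) 0⌋₊ = ⌊y⌋₊ - n := by
  rw [← Nat.floor_sub_natCast]
  rcases le_total 0 (y - n) with h | h
  · rw [max_eq_left h]
  · rw [max_eq_right h, Nat.floor_of_nonpos h, Nat.floor_zero]

/-- The distance from `y` to the next integer is at least `2^{-d}`. -/
def FloorGap (d : ℕ) (y : ℝ) : Prop := 0 ≤ y ∧ y ≤ ⌊y⌋₊ + 1 - ((2 : ℝ) ^ d)⁻¹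

theorem two_pow_inv_le_one (d : ℕ) : ((2 : ℝ) ^ d)⁻¹ ≤ 1 :=
  inv_le_one_of_one_le₀ (one_le_pow₀ one_le_two)

theorem FloorGap.max_sub {d : ℕ} {y : ℝ} (h : FloorGap d y) (n : ℕ) :
    FloorGap d (max (y - n) 0) := by
  refine ⟨le_max_right _ _, ?_⟩
  rw [floor_max_sub_natCast]
  have := two_pow_inv_le_one d
  refine max_le ?_ (by linarith [Nat.cast_nonneg (α := ℝ) (⌊y⌋₊ - n)])
  have h1 : (⌊y⌋₊ : ℝ) ≤ (⌊y⌋₊ - n : ℕ) + n := by exact_mod_cast le_tsub_add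
  linarith [h.2]

namespace Reach

variable {α ι : Type} [Fintype ι] {g W k s : ℕ} {inp : α → ℝ} {v : α → ι → ℝ}

/-- The result keeps the factor `2^{-d}`: the steps then need only bounded slopes, and the rescaling
by `2^d` can be paid once, after all rounds, instead of in each round. -/
theorem append_min_floor (h : Reach g W k s inp v) {M : ℝ} {Y : α → ℝ} (hY : Aff g M v Y)
    {d : ℕ} (hd : d ≤ g) (hgap : ∀ a, FloorGap d (Y a)) (n t : ℕ) (hM : 1 ≤ M)
    (ht : M + 2 * n + 1 ≤ 2 ^ t) (hW : Fintype.card ι + (n + n) + 1 ≤ W) :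
    Reach g W (k + 2) (s + t + t) inp
      (ext v fun a => (min ⌊Y a⌋₊ n : ℕ) * ((2 : ℝ) ^ d)⁻¹) := by
  have hδ := two_pow_inv_le_one d
  have hδ0 : (0 : ℝ) ≤ (2 ^ d)⁻¹ := by positivity
  have hδg : ((2 : ℝ) ^ d)⁻¹ ∈ grid g := grid_mono hd (two_pow_inv_mem_grid d)
  have hn : (0 : ℝ) ≤ n := n.cast_nonneg
  -- The constant zero channel only makes the index type nonempty when `ι` is empty and `n = 0`.
  let w : α → Option (ι ⊕ (Fin n ⊕ Fin n)) → ℝ := fun a o => o.elim 0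
    (Sum.elim (v a) (Sum.elim (fun j => max (Y a - (j + 1 : ℕ) + (2 ^ d)⁻¹) 0)
      fun j => max (Y a - (j + 1 : ℕ)) 0))
  have h1 : Reach g W (k + 1) (s + t) inp w := by
    refine h.layer t w (by simpa using hW) ?_
    have hj (j : Fin n) : ((j + 1 : ℕ) : ℝ) ≤ n := by exact_mod_cast j.2
    rintro (_ | i | j | j)
    · exact .zero (by positivity)
    · exact .of_nonneg (.coord i) (by linarith) fun a => h.nonneg a i
    · refine .relu ((hY.sub (.natCast _)).add (.const hδg)) ?_
      rw [abs_of_nonneg hδ0]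
      linarith [hj j]
    · exact .relu (hY.sub (.natCast _)) (by linarith [hj j])
  refine h1.layer t _ (by simp; omega) ?_
  rintro (_ | i)
  · refine .of_nonneg (M := (Finset.univ : Finset (Fin n)).card * (1 + 1))
      (f := fun a => (min ⌊Y a⌋₊ n : ℕ) * ((2 : ℝ) ^ d)⁻¹) ?_
      (by simp; linarith) fun a => by positivity
    refine (Aff.sum Finset.univ fun (j : Fin n) _ =>
      (Aff.coord (v := w) (some (.inr (.inl j)))).sub
        (Aff.coord (v := w) (some (.inr (.inr j))))).congr fun a => ?_
    rw [← sum_ramp_eq_min_floor hδ0 (hgap a).1 (hgap a).2, Finset.sum_range]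
    rfl
  · exact .of_nonneg (Aff.coord (v := w) (some (.inl i))) (by linarith) fun a => h.nonneg a i

/-- Width of order `n` counts `n` levels at a time; `R` rounds, each lowering the remainder by `n`,
reach `nR` levels. Width is thus traded for depth. -/
theorem append_floor (h : Reach g W k s inp v) {M : ℝ} {Y : α → ℝ} (hY : Aff g M v Y)
    {d : ℕ} (hd : d ≤ g) (hgap : ∀ a, FloorGap d (Y a)) (n R t₀ t : ℕ)
    (hYR : ∀ a, ⌊Y a⌋₊ ≤ n * R) (hM : M ≤ 2 ^ t₀) (ht : 2 * n + 2 ≤ 2 ^ t)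
    (hW : Fintype.card ι + (n + n) + 3 ≤ W) :
    Reach g W (k + 3 * R + 3) (s + t₀ + 3 * R * t + d) inp (ext v fun a => (⌊Y a⌋₊ : ℝ)) := by
  have ht' : (2 : ℝ) * n + 2 ≤ 2 ^ t := by exact_mod_cast ht
  have hn : (0 : ℝ) ≤ n := n.cast_nonneg
  have key : ∀ r ≤ R, Reach g W (k + 3 * r + 2) (s + t₀ + 3 * r * t) inp
      (ext (ext v fun a => max (Y a - (n * r : ℕ)) 0)
        fun a => (min ⌊Y a⌋₊ (n * r) : ℕ) * ((2 : ℝ) ^ d)⁻¹) := by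
    intro r hr
    induction r with
    | zero =>
      have h1 := (h.append t₀ (.relu hY hM) (by omega)).append 0
        (.zero (by positivity)) (by simp; omega)
      refine (h1.mono (by omega) (by omega)).congr fun a i => ?_
      rcases i with _ | _ | i <;> simp
    | succ r ih =>
      have h1 := ih (by omega)
      have h2 := h1.append_min_floor (.coord (some none)) hd (fun a => (hgap a).max_sub _) n t
        le_rfl (by linarith) (by simp; omega)
      refine (h2.layer t (ext (ext v fun a => max (Y a - (n * (r + 1) : ℕ)) 0)
        fun a => (min ⌊Y a⌋₊ (n * (r + 1)) : ℕ) * ((2 : ℝ) ^ d)⁻¹) (by simp; omega) ?_).mono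
        (by omega) (le_of_eq (by ring))
      rintro (_ | _ | i)
      · refine .of_nonneg (M := 1 + 1) ?_ (by linarith) fun a => by simp only [ext_none]; positivity
        refine ((Aff.coord (some none)).add (.coord none)).congr fun a => ?_
        simp only [ext_none, ext_some, floor_max_sub_natCast]
        rw [← add_mul, ← Nat.cast_add]
        congr 2
        rw [mul_add, mul_one]
        omega
      · refine ⟨_, ((Aff.coord (g := g) (some (some none))).sub (.natCast n)).mono
          (by linarith), fun a => ?_⟩
        simp only [ext_none, ext_some]
        push_cast
        rw [mul_add, mul_one]
        rcases le_total (Y a - n * r) 0 with h0 | h0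
        · rw [max_eq_right h0, max_eq_right (by linarith), max_eq_right (by linarith)]
        · rw [max_eq_left h0]
          congr 1; ring
      · exact .of_nonneg (Aff.coord (some (some (some i)))) (by linarith) fun a => h.nonneg a i
  refine ((key R le_rfl).layer d _ (by simp; omega) ?_)
  rintro (_ | i)
  · refine .of_nonneg (M := (2 ^ d : ℕ) * 1) (f := fun a => (⌊Y a⌋₊ : ℝ)) ?_ (by simp)
      fun a => by positivity
    refine ((Aff.coord none).natCast_mul (2 ^ d)).congr fun a => ?_
    rw [ext_none, min_eq_left (hYR a)]
    push_cast
    field_simp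
  · exact .of_nonneg (Aff.coord (some (some i))) (one_le_pow₀ one_le_two) fun a => h.nonneg a i

end Reach

/-! ### Table lookup -/

/-- A second difference of ramps is a hat function, and at integers a hat is an indicator. -/
theorem hat_eq_ite (p i : ℕ) :
    max ((p : ℝ) + 1 - i) 0 - 2 * max ((p : ℝ) + 1 - (i + 1 : ℕ)) 0 +
      max ((p : ℝ) + 1 - (i + 2 : ℕ)) 0 = if p = i then 1 else 0 := by
  push_cast
  rcases lt_trichotomy p i with h | rfl | h
  · have : (p : ℝ) + 1 ≤ i := by exact_mod_cast h
    rw [max_eq_right (by linarith), max_eq_right (by linarith), max_eq_right (by linarith),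
      if_neg h.ne]
    ring
  · rw [max_eq_left (by linarith), max_eq_right (by linarith), max_eq_right (by linarith),
      if_pos rfl]
    ring
  · have : (i : ℝ) + 1 ≤ p := by exact_mod_cast h
    rw [max_eq_left (by linarith), max_eq_left (by linarith), max_eq_left (by linarith),
      if_neg h.ne']
    ring

namespace Reach

variable {α ι : Type} [Fintype ι] {g W k s : ℕ} {inp : α → ℝ} {v : α → ι → ℝ}

/-- Row indicators select the entries `T (p a) j` linearly for all columns `j`; a ReLU then
suppresses every column except `j = q a`, and a sum collects the survivor. Only order `n₁ + n₂`
neurons are needed for `n₁ n₂` entries. -/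
theorem append_lookup (h : Reach g W k s inp v) {M : ℝ} {p q : α → ℕ}
    (hp : Aff g M v fun a => (p a : ℝ)) (hq : Aff g M v fun a => (q a : ℝ)) {n₁ n₂ : ℕ}
    (hpn : ∀ a, p a < n₁) (hqn : ∀ a, q a < n₂) (T : ℕ → ℕ → ℝ) (M₀ : ℕ)
    (hT : ∀ i < n₁, ∀ j < n₂, T i j ∈ grid g ∧ 0 ≤ T i j ∧ T i j ≤ M₀) (t : ℕ)
    (hM : 1 ≤ M) (ht₁ : M + n₁ + n₂ + 2 ≤ 2 ^ t) (ht₂ : n₁ * (M₀ * 4) + M₀ * 5 ≤ 2 ^ t)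
    (hW : Fintype.card ι + n₁ + n₂ + 4 ≤ W) :
    Reach g W (k + 3) (s + 3 * t) inp (ext v fun a => T (p a) (q a)) := by
  have hn₁ : (0 : ℝ) ≤ n₁ := n₁.cast_nonneg
  have hn₂ : (0 : ℝ) ≤ n₂ := n₂.cast_nonneg
  have ht₂' : (n₁ : ℝ) * (M₀ * 4) + M₀ * 5 ≤ 2 ^ t := by exact_mod_cast ht₂
  have h2t : (1 : ℝ) ≤ 2 ^ t := one_le_pow₀ one_le_two
  let w : α → ι ⊕ (Fin (n₁ + 2) ⊕ Fin (n₂ + 2)) → ℝ := fun a =>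
    Sum.elim (v a) (Sum.elim (fun i => max ((p a : ℝ) + 1 - (i : ℕ)) 0)
      fun j => max ((q a : ℝ) + 1 - (j : ℕ)) 0)
  have h1 : Reach g W (k + 1) (s + t) inp w := by
    refine h.layer t w (by simp; omega) ?_
    rintro (i | j | j)
    · exact .of_nonneg (.coord i) h2t fun a => h.nonneg a i
    · have hj : ((j : ℕ) : ℝ) + 1 ≤ n₁ + 2 := by exact_mod_cast j.2
      exact .relu ((hp.add .one).sub (.natCast _)) (by linarith)
    · have hj : ((j : ℕ) : ℝ) + 1 ≤ n₂ + 2 := by exact_mod_cast j.2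
      exact .relu ((hq.add .one).sub (.natCast _)) (by linarith)
  have hat₁ (i : Fin n₁) : Aff 0 4 w fun a => if p a = i then (1 : ℝ) else 0 :=
    ((((Aff.coord (v := w) (.inr (.inl ⟨i, by omega⟩))).sub
      ((Aff.coord (v := w) (.inr (.inl ⟨i + 1, by omega⟩))).natCast_mul 2)).add
      (Aff.coord (v := w) (.inr (.inl ⟨i + 2, by omega⟩)))).mono (by norm_num)).congr fun a => by
        rw [← hat_eq_ite]; simp [w]
  have hat₂ (j : Fin n₂) : Aff 0 4 w fun a => if q a = j then (1 : ℝ) else 0 :=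
    ((((Aff.coord (v := w) (.inr (.inr ⟨j, by omega⟩))).sub
      ((Aff.coord (v := w) (.inr (.inr ⟨j + 1, by omega⟩))).natCast_mul 2)).add
      (Aff.coord (v := w) (.inr (.inr ⟨j + 2, by omega⟩)))).mono (by norm_num)).congr fun a => by
        rw [← hat_eq_ite]; simp [w]
  let w' : α → Option (ι ⊕ Fin n₂) → ℝ := fun a o => o.elim 0
    (Sum.elim (v a) fun j => if q a = j then T (p a) j else 0)
  have h2 : Reach g W (k + 1 + 1) (s + t + t) inp w' := by
    refine h1.layer t w' (by simp; omega) ?_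
    rintro (_ | i | j)
    · exact .zero (by positivity)
    · exact .of_nonneg (Aff.coord (v := w) (.inl i)) h2t fun a => h.nonneg a i
    -- The neuron is `max (T (p a) j + M₀ (1_{q = j} - 1)) 0`; since `0 ≤ T ≤ M₀`, the penalty kills
    -- it exactly when `q a ≠ j`.
    · refine ⟨_, ((Aff.sum (M := M₀ * 4) Finset.univ fun (i : Fin n₁) _ =>
        ((hat₁ i).grid_mul (hT i i.2 j j.2).1).mono ?_).add
        (((hat₂ j).of_zero.sub .one).natCast_mul M₀)).mono ?_, fun a => ?_⟩
      · rw [abs_of_nonneg (hT i i.2 j j.2).2.1]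
        linarith [(hT i i.2 j j.2).2.2]
      · simp only [Finset.card_univ, Fintype.card_fin]
        linarith
      · have hs : ∑ i : Fin n₁, T i j * (if p a = i then (1 : ℝ) else 0) = T (p a) j := by
          rw [Finset.sum_eq_single ⟨p a, hpn a⟩]
          · simp
          · intro i _ hi
            rw [if_neg fun h => hi (Fin.ext h.symm), mul_zero]
          · simp
        obtain ⟨-, h0, h1⟩ := hT (p a) (hpn a) j j.2
        simp only [w', Option.elim_some, Sum.elim_inr, hs]
        split_ifs
        · rw [max_eq_left (by linarith)]; ring
        · rw [max_eq_right (by linarith)]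
  refine (h2.layer t (ext v fun a => T (p a) (q a)) (by simp; omega) ?_).mono le_rfl
    (le_of_eq (by ring))
  rintro (_ | i)
  · refine .of_nonneg (M := (Finset.univ : Finset (Fin n₂)).card * 1)
      (f := fun a => T (p a) (q a)) ?_ (by simp; linarith)
      fun a => (hT _ (hpn a) _ (hqn a)).2.1
    refine (Aff.sum Finset.univ fun (j : Fin n₂) _ =>
      Aff.coord (v := w') (some (.inr j))).congr fun a => ?_
    simp only [w', Option.elim_some, Sum.elim_inr]
    rw [Finset.sum_eq_single ⟨q a, hqn a⟩]
    · simp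
    · intro j _ hj
      rw [if_neg fun h => hj (Fin.ext h.symm)]
    · simp
  · exact .of_nonneg (Aff.coord (v := w') (some (.inl i))) h2t fun a => h.nonneg a i

/-- The `R` slices are read one after another. A channel `max (c + 1 - r) 0` acts as a counter whose
second difference is the indicator of `c = r`, and only the matching slice is added to the
accumulator. -/
theorem append_lookup₃ (h : Reach g W k s inp v) {p q c : α → ℕ} {ip iq ic : ι}
    (hp : ∀ a, v a ip = p a) (hq : ∀ a, v a iq = q a) (hc : ∀ a, v a ic = c a) {n R : ℕ}
    (hpn : ∀ a, p a < n) (hqn : ∀ a, q a < n) (hcR : ∀ a, c a < R) (T : ℕ → ℕ → ℕ → ℝ)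
    (hT : ∀ r < R, ∀ i < n, ∀ j < n, T r i j ∈ grid g ∧ 0 ≤ T r i j ∧ T r i j ≤ 1) (t : ℕ)
    (ht : 4 * n + 6 ≤ 2 ^ t) (hW : Fintype.card ι + 2 * n + 7 ≤ W) :
    Reach g W (k + 7 * R + 3) (s + (7 * R + 3) * t) inp
      (ext v fun a => T (c a) (p a) (q a)) := by
  have ht' : (4 : ℝ) * n + 6 ≤ 2 ^ t := by exact_mod_cast ht
  have hn : (0 : ℝ) ≤ n := n.cast_nonneg
  have h0 (a : α) (r : ℕ) (hr : r < R) : 0 ≤ T r (p a) (q a) := (hT r hr _ (hpn a) _ (hqn a)).2.1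
  have h1 (a : α) (r : ℕ) (hr : r < R) : T r (p a) (q a) ≤ 1 := (hT r hr _ (hpn a) _ (hqn a)).2.2
  have key : ∀ r ≤ R, Reach g W (k + 7 * r + 2) (s + (7 * r + 2) * t) inp
      (ext (ext v fun a => max ((c a : ℝ) + 1 - r) 0)
        fun a => if c a < r then T (c a) (p a) (q a) else 0) := by
    intro r hr
    induction r with
    | zero =>
      have h1 := (h.append t (.relu ((Aff.coord ic).add .one) (by linarith)) (by omega)).append t
        (.zero (by positivity)) (by simp; omega)
      refine (h1.mono (by omega) (le_of_eq (by ring))).congr fun a i => ?_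
      rcases i with _ | _ | i <;> simp [hc]
    | succ r ih =>
      have hrR : r < R := hr
      have e1 := (ih hrR.le).append_lookup (p := p) (q := q) (n₁ := n) (n₂ := n)
        ((Aff.coord (some (some ip))).congr fun a => hp a)
        ((Aff.coord (some (some iq))).congr fun a => hq a) hpn hqn (T r) 1
        (by simpa using hT r hrR) t le_rfl (by linarith) (by push_cast; linarith)
        (by simp; omega)
      have e2 := e1.append t (.relu ((Aff.coord (some (some none))).sub .one) (by linarith))
        (by simp; omega)
      have e3 := e2.append t (.relu ((Aff.coord (some (some (some none)))).sub (.natCast 2))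
        (by push_cast; linarith)) (by simp; omega)
      -- This is `max (1_{c = r} + T_r - 1) 0`, the product of the indicator with a value in
      -- `[0,1]`.
      have e4 := e3.append t (.relu (((((Aff.coord (some (some (some (some none))))).sub
        ((Aff.coord (some none)).natCast_mul 2)).add (Aff.coord none)).add
        (Aff.coord (some (some none)))).sub .one) (by push_cast; linarith)) (by simp; omega)
      refine (e4.layer t (ext (ext v fun a => max ((c a : ℝ) + 1 - (r + 1 : ℕ)) 0)
        fun a => if c a < r + 1 then T (c a) (p a) (q a) else 0) (by simp; omega) ?_).mono
        (by omega) (le_of_eq (by ring))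
      have c1 (a : α) : max (max ((c a : ℝ) + 1 - r) 0 - 1) 0 =
          max ((c a : ℝ) + 1 - (r + 1 : ℕ)) 0 := by
        push_cast
        rcases le_total ((c a : ℝ) + 1 - r) 0 with h | h
        · rw [max_eq_right h, max_eq_right (by linarith), max_eq_right (by linarith)]
        · rw [max_eq_left h]; congr 1; ring
      have c2 (a : α) : max (max ((c a : ℝ) + 1 - r) 0 - (2 : ℕ)) 0 =
          max ((c a : ℝ) + 1 - (r + 2 : ℕ)) 0 := by
        push_cast
        rcases le_total ((c a : ℝ) + 1 - r) 0 with h | h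
        · rw [max_eq_right h, max_eq_right (by linarith), max_eq_right (by linarith)]
        · rw [max_eq_left h]; congr 1; ring
      rintro (_ | _ | i)
      · refine .of_nonneg (((Aff.coord (some (some (some (some none))))).add
          (Aff.coord none)).congr fun a => ?_) (by linarith) fun a => ?_
        · simp only [ext_none, ext_some, c1, c2]
          have := hat_eq_ite (c a) r
          rw [Nat.cast_ofNat, this]
          rcases lt_trichotomy (c a) r with h | h | h
          · rw [if_pos h, if_neg h.ne, if_pos (by omega), max_eq_right (by linarith [h1 a r hrR])]
            ring
          · rw [if_neg (by omega), if_pos h, if_pos (by omega), h,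
              max_eq_left (by linarith [h0 a r hrR])]
            ring
          · rw [if_neg (by omega), if_neg h.ne', if_neg (by omega),
              max_eq_right (by linarith [h1 a r hrR])]
            ring
        · simp only [ext_none]
          split_ifs
          exacts [h0 a _ (hcR a), le_rfl]
      · exact .of_nonneg ((Aff.coord (some (some none))).congr fun a => c1 a) (by linarith)
          fun a => le_max_right _ _
      · exact .of_nonneg (Aff.coord (some (some (some (some (some (some i))))))) (by linarith)
          fun a => h.nonneg a i
  refine ((key R le_rfl).layer t _ (by simp; omega) ?_).mono le_rfl (le_of_eq (by ring))
  rintro (_ | i)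
  · exact .of_nonneg ((Aff.coord none).congr fun a => by simp [hcR]) (by linarith)
      fun a => h0 a _ (hcR a)
  · exact .of_nonneg (Aff.coord (some (some i))) (by linarith) fun a => h.nonneg a i

end Reach

/-! ### Extracting digits -/

/-- The number `∑_{t < n} D t · 2^{-(m + 1)(t + 1)}`. -/
def digitVal (m : ℕ) (D : ℕ → ℕ) : ℕ → ℝ
  | 0 => 0
  | n + 1 => (D 0 + digitVal m (fun t => D (t + 1)) n) / 2 ^ (m + 1)

theorem digitVal_nonneg (m : ℕ) (D : ℕ → ℕ) (n : ℕ) : 0 ≤ digitVal m D n := by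
  induction n generalizing D with
  | zero => exact le_rfl
  | succ n ih => exact div_nonneg (add_nonneg (Nat.cast_nonneg _) (ih _)) (by positivity)

/-- The base is `2^{m+1}` although digits are below `2^m`. The spare bit keeps every tail at most
`1/2`, which provides the gap needed to read the next digit by an integer part. -/
theorem digitVal_le_half {m : ℕ} {D : ℕ → ℕ} {n : ℕ} (hD : ∀ t < n, D t < 2 ^ m) :
    digitVal m D n ≤ 1 / 2 := by
  induction n generalizing D with
  | zero => simp [digitVal]
  | succ n ih =>
    have h1 : (D 0 : ℝ) + 1 ≤ 2 ^ m := by exact_mod_cast hD 0 n.succ_pos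
    have h2 := ih (D := fun t => D (t + 1)) fun t ht => hD _ (by omega)
    rw [digitVal, div_le_iff₀ (by positivity), pow_succ]
    linarith

theorem digitVal_mem_grid (m : ℕ) (D : ℕ → ℕ) (n : ℕ) :
    digitVal m D n ∈ grid ((m + 1) * n) := by
  induction n generalizing D with
  | zero => exact zero_mem _
  | succ n ih => exact div_two_pow_mem_grid (add_mem (natCast_mem_grid _ _) (ih _)) _

namespace Reach

variable {α ι : Type} [Fintype ι] {g W k s : ℕ} {inp : α → ℝ} {v : α → ι → ℝ}

/-- Round `r` multiplies the tail by `2^{m+1}`, splits off its integer part as the digit, and looks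
up `Q` at this digit and at `min (c - r * m) m`, the part of the count `c` falling in the `r`-th
block. The state is the tail, the remaining count and the partial sum. -/
theorem append_digit_sum (h : Reach g W k s inp v) {iθ ic : ι} {D : α → ℕ → ℕ} {c : α → ℕ}
    {m R : ℕ} (hθ : ∀ a, v a iθ = digitVal m (D a) R) (hc : ∀ a, v a ic = c a)
    (hD : ∀ a, ∀ t < R, D a t < 2 ^ m) (Q : ℕ → ℕ → ℕ) (hQ : ∀ d < 2 ^ m, ∀ i ≤ m, Q d i ≤ m)
    (hg : 1 ≤ g) (t : ℕ) (ht : (2 ^ m + 1) * (5 * m + 8) ≤ 2 ^ t)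
    (hW : Fintype.card ι + 2 * 2 ^ m + m + 12 ≤ W) :
    Reach g W (k + 12 * R + 4) (s + (11 * R + 4) * t) inp
      (ext v fun a => ((∑ r ∈ Finset.range R, Q (D a r) (min (c a - r * m) m) : ℕ) : ℝ)) := by
  have ht' : ((2 : ℝ) ^ m + 1) * (5 * m + 8) ≤ 2 ^ t := by exact_mod_cast ht
  have hm : (0 : ℝ) ≤ m := m.cast_nonneg
  have h2m : (1 : ℝ) ≤ 2 ^ m := one_le_pow₀ one_le_two
  have hmm : (0 : ℝ) ≤ 2 ^ m * m := by positivity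
  have h2t : (1 : ℝ) ≤ 2 ^ t := one_le_pow₀ one_le_two
  have ht0 : 1 ≤ t := by
    rcases Nat.eq_zero_or_pos t with rfl | h
    · norm_num at ht'; linarith
    · exact h
  have hbd₁ : 2 * 2 ^ m + 2 ≤ 2 ^ t := by
    have : (2 : ℝ) * 2 ^ m + 2 ≤ 2 ^ t := by linarith
    exact_mod_cast this
  have hbd₂ : 2 ^ m * (m * 4) + m * 5 ≤ 2 ^ t := by
    have : (2 : ℝ) ^ m * (m * 4) + m * 5 ≤ 2 ^ t := by linarith
    exact_mod_cast this
  have key : ∀ r ≤ R, Reach g W (k + 12 * r + 3) (s + (11 * r + 3) * t) inp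
      (ext (ext (ext v fun a => digitVal m (fun t => D a (r + t)) (R - r))
        fun a => ((c a - r * m : ℕ) : ℝ))
        fun a => ((∑ r ∈ Finset.range r, Q (D a r) (min (c a - r * m) m) : ℕ) : ℝ)) := by
    intro r hr
    induction r with
    | zero =>
      have h1 := ((h.append t (.of_nonneg (.coord iθ) h2t fun a => h.nonneg a iθ)
        (by omega)).append t (.of_nonneg (.coord (some ic)) h2t fun a => h.nonneg a ic)
        (by simp; omega)).append t (.zero (by positivity)) (by simp; omega)
      refine (h1.mono (by omega) (le_of_eq (by ring))).congr fun a i => ?_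
      rcases i with _ | _ | _ | i
      · simp only [ext_none, Finset.range_zero, Finset.sum_empty, Nat.cast_zero]
      · simp only [ext_none, ext_some, hc, zero_mul, Nat.sub_zero]
      · simp only [ext_none, ext_some, zero_add, Nat.sub_zero]
        exact hθ a
      · rfl
    | succ r ih =>
      have hrR : r < R := hr
      obtain ⟨n, rfl⟩ : ∃ n, R = r + 1 + n := Nat.exists_eq_add_of_le hr
      have hrec (a : α) : (2 ^ (m + 1) : ℕ) * digitVal m (fun t => D a (r + t)) (r + 1 + n - r) =
          D a r + digitVal m (fun t => D a (r + 1 + t)) n := by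
        rw [show r + 1 + n - r = n + 1 by omega, digitVal]
        push_cast
        rw [mul_div_cancel₀ _ (by positivity), add_zero]
        rw [show (fun t => D a (r + (t + 1))) = fun t => D a (r + 1 + t) from
          funext fun t => by congr 1; omega]
      have hhalf (a : α) : digitVal m (fun t => D a (r + 1 + t)) n ≤ 1 / 2 :=
        digitVal_le_half fun t ht => hD a _ (by omega)
      have hpos (a : α) := digitVal_nonneg m (fun t => D a (r + 1 + t)) n
      have hfl (a : α) : ⌊(2 ^ (m + 1) : ℕ) *
          digitVal m (fun t => D a (r + t)) (r + 1 + n - r)⌋₊ = D a r := by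
        rw [hrec, Nat.floor_eq_iff (add_nonneg (Nat.cast_nonneg _) (hpos a))]
        constructor <;> linarith [hhalf a, hpos a]
      have e1 := (ih hrR.le).append_floor (d := 1)
        ((Aff.coord (some (some none))).natCast_mul (2 ^ (m + 1))) hg (fun a => by
          simp only [ext_none, ext_some, FloorGap, hfl]
          rw [hrec]
          constructor <;> linarith [hhalf a, hpos a, (Nat.cast_nonneg (D a r) : (0 : ℝ) ≤ _)])
        (2 ^ m) 1 t t
        (fun a => by simp only [ext_none, ext_some, hfl, mul_one]; exact (hD a r hrR).le)
        (by push_cast; rw [pow_succ]; linarith) hbd₁ (by simp; omega)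
      simp only [ext_none, ext_some, hfl] at e1
      have e2 := e1.append t (.relu ((Aff.coord (some (some none))).sub (.natCast m))
        (by linarith)) (by simp; omega)
      have e3 := e2.append t (.relu ((Aff.coord (some (some (some none)))).sub (.coord none))
        (by linarith)) (by simp; omega)
      have c1 (a : α) : max (((c a - r * m : ℕ) : ℝ) - m) 0 = (c a - (r + 1) * m : ℕ) := by
        rw [show c a - (r + 1) * m = c a - r * m - m by rw [Nat.sub_sub]; congr 1; ring]
        rcases le_total m (c a - r * m) with h | h
        · rw [Nat.cast_sub h, max_eq_left]
          exact sub_nonneg.2 (by exact_mod_cast h)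
        · rw [Nat.sub_eq_zero_of_le h, max_eq_right, Nat.cast_zero]
          exact sub_nonpos.2 (by exact_mod_cast h)
      have c2 (a : α) : max (((c a - r * m : ℕ) : ℝ) - (c a - (r + 1) * m : ℕ)) 0 =
          (min (c a - r * m) m : ℕ) := by
        rw [show c a - (r + 1) * m = c a - r * m - m by rw [Nat.sub_sub]; congr 1; ring,
          ← Nat.cast_sub (by omega), max_eq_left (by positivity)]
        congr 1; omega
      simp only [ext_none, ext_some, c1, c2] at e3
      have e4 := e3.append_lookup (p := fun a => D a r) (q := fun a => min (c a - r * m) m)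
        (n₁ := 2 ^ m) (n₂ := m + 1) (Aff.coord (some (some none))) (Aff.coord none)
        (fun a => hD a r hrR) (fun a => by omega) (fun i j => (Q i j : ℝ)) m
        (fun i hi j hj => ⟨natCast_mem_grid _ _, Nat.cast_nonneg _,
          by exact_mod_cast hQ i hi j (by omega)⟩) t le_rfl (by push_cast; linarith)
        hbd₂ (by simp; omega)
      refine (e4.layer t (ext (ext (ext v
        fun a => digitVal m (fun t => D a (r + 1 + t)) (r + 1 + n - (r + 1)))
        fun a => ((c a - (r + 1) * m : ℕ) : ℝ))
        fun a => ((∑ r ∈ Finset.range (r + 1), Q (D a r) (min (c a - r * m) m) : ℕ) : ℝ))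
        (by simp; omega) ?_).mono (by omega) (by nlinarith)
      rintro (_ | _ | _ | i)
      · refine .of_nonneg (((Aff.coord (some (some (some (some none))))).add
          (Aff.coord none)).congr fun a => ?_) (by linarith)
          fun a => by simp only [ext_none]; positivity
        simp [Finset.sum_range_succ]
      · exact .of_nonneg ((Aff.coord (some (some none))).congr fun a => rfl) (by linarith)
          fun a => Nat.cast_nonneg _
      · refine .of_nonneg ((((Aff.coord (some (some (some (some (some (some none))))))).natCast_mul
          (2 ^ (m + 1))).sub (Aff.coord (some (some (some none))))).congr fun a => ?_)
          (by push_cast; rw [pow_succ]; linarith) fun a => digitVal_nonneg _ _ _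
        simp only [ext_none, ext_some, hrec]
        rw [show r + 1 + n - (r + 1) = n by omega, add_sub_cancel_left]
      · exact .of_nonneg (Aff.coord (some (some (some (some (some (some (some i)))))))) h2t
          fun a => h.nonneg a i
  refine ((key R le_rfl).layer t _ (by simp; omega) ?_).mono le_rfl (le_of_eq (by ring))
  rintro (_ | i)
  · exact .of_nonneg (Aff.coord none) h2t fun a => Nat.cast_nonneg _
  · exact .of_nonneg (Aff.coord (some (some (some i)))) h2t fun a => h.nonneg a i

end Reach

/-! ### The network on good samples -/

theorem floor_natCast_add_div {k : ℕ} {f : ℝ} (hf₀ : 0 ≤ f) (hf₁ : f < 1) (n : ℕ) :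
    ⌊((k : ℝ) + f) / n⌋₊ = k / n := by
  rw [Nat.floor_div_natCast, Nat.floor_eq_iff (by positivity) |>.2 ⟨by linarith, by linarith⟩]

theorem add_div_sub_floor (k : ℕ) (f : ℝ) {n : ℕ} (hn : 0 < n) :
    ((k : ℝ) + f) / n - (k / n : ℕ) = ((k % n : ℕ) + f) / n := by
  have hn' : (0 : ℝ) < n := by exact_mod_cast hn
  have : (k : ℝ) = n * (k / n : ℕ) + (k % n : ℕ) := by exact_mod_cast (Nat.div_add_mod k n).symm
  rw [eq_div_iff hn'.ne', sub_mul, div_mul_cancel₀ _ hn'.ne']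
  linarith

/-- The fractional part is `(k % n + f) / n ≤ (n - 1/4) / n`, so coarser integer parts inherit a gap
`1 / (4n)` from `f ≤ 3/4`. -/
theorem floorGap_add_div {k : ℕ} {f : ℝ} (hf₀ : 0 ≤ f) (hf₁ : f ≤ 3 / 4) {n d : ℕ} (hn : 0 < n)
    (hd : 4 * n ≤ 2 ^ d) : FloorGap d (((k : ℝ) + f) / n) := by
  have hn' : (0 : ℝ) < n := by exact_mod_cast hn
  have hd' : (4 : ℝ) * n ≤ 2 ^ d := by exact_mod_cast hd
  refine ⟨by positivity, ?_⟩
  rw [floor_natCast_add_div hf₀ (by linarith)]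
  have h1 := add_div_sub_floor k f hn
  have h2 : ((k % n : ℕ) : ℝ) + 1 ≤ n := by exact_mod_cast Nat.mod_lt k hn
  have h3 : (((k % n : ℕ) : ℝ) + f) / n ≤ 1 - 1 / (4 * n) := by
    rw [div_le_iff₀ hn', sub_mul, div_mul_eq_mul_div, mul_comm (4 : ℝ), ← div_div,
      mul_div_assoc, one_mul, div_self hn'.ne']
    linarith
  have h4 : ((2 : ℝ) ^ d)⁻¹ ≤ 1 / (4 * n) := by
    rw [one_div]; exact inv_anti₀ (by positivity) hd'
  linarith

namespace Reach

variable {α ι : Type} [Fintype ι] {g W k s : ℕ} {inp : α → ℝ} {v : α → ι → ℝ}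

/-- One step of mixed-radix expansion. The same offset `f` survives in the remainder, so the step
can be iterated with the same gap hypothesis. -/
theorem append_digit (h : Reach g W k s inp v) {iy : ι} {κ : α → ℕ} {f : α → ℝ}
    (hf₀ : ∀ a, 0 ≤ f a) (hf₁ : ∀ a, f a ≤ 3 / 4) {n R K' : ℕ} (hK' : 0 < K')
    (hnR : 0 < n * R) (hκ : ∀ a, κ a < n * R * K')
    (hy : ∀ a, v a iy = (κ a + f a) / (n * R * K' : ℕ)) {d t : ℕ} (hdg : d ≤ g)
    (hd : 4 * (n * R * K') ≤ 2 ^ d) (ht : 2 * n + 2 ≤ 2 ^ t)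
    (hW : Fintype.card ι + (n + n) + 3 ≤ W) :
    Reach g W (k + 3 * R + 4) (s + 3 * R * t + 3 * d) inp
      (ext (ext v fun a => ((κ a / K' : ℕ) : ℝ)) fun a => ((κ a % K' : ℕ) + f a) / K') := by
  have hK'' : (0 : ℝ) < K' := by exact_mod_cast hK'
  have hnR' : (0 : ℝ) < (n * R : ℕ) := by exact_mod_cast hnR
  have hd' : 4 * (n * R) ≤ 2 ^ d := (Nat.mul_le_mul_left 4 (Nat.le_mul_of_pos_right _ hK')).trans hd
  have hd'' : (4 : ℝ) * (n * R : ℕ) ≤ 2 ^ d := by exact_mod_cast hd'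
  have h1R : (1 : ℝ) ≤ (n * R : ℕ) := by exact_mod_cast hnR
  have hY (a : α) : (n * R : ℕ) * v a iy = (κ a + f a) / K' := by
    rw [hy, Nat.cast_mul (n * R) K']
    field_simp
  have hfl (a : α) : ⌊(n * R : ℕ) * v a iy⌋₊ = κ a / K' := by
    rw [hY, floor_natCast_add_div (hf₀ a) (by linarith [hf₁ a])]
  have e1 := h.append_floor ((Aff.coord iy).natCast_mul (n * R)) hdg
    (fun a => by
      rw [hY]
      refine floorGap_add_div (hf₀ a) (hf₁ a) hK' (le_trans ?_ hd)
      exact Nat.mul_le_mul_left 4 (Nat.le_mul_of_pos_left _ hnR))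
    n R d t (fun a => by rw [hfl]; exact Nat.div_le_of_le_mul (by rw [mul_comm]; exact (hκ a).le))
    (by linarith) ht hW
  simp only [hfl] at e1
  refine (e1.append d (.of_nonneg ((((Aff.coord (some iy)).natCast_mul (n * R)).sub
    (Aff.coord none)).congr fun a => ?_) (by linarith) fun a => ?_) (by simp; omega)).mono
    (by omega) (le_of_eq (by ring))
  · rw [ext_some, ext_none, hY, add_div_sub_floor _ _ hK']
  · have := hf₀ a
    positivity

end Reach

/-! ### Counting bits -/

/-- The number of ones among the first `i` binary digits of `d`. -/
def bitCount (d i : ℕ) : ℕ := ∑ j ∈ Finset.range i, (d.testBit j).toNat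

theorem bitCount_le (d i : ℕ) : bitCount d i ≤ i :=
  (Finset.sum_le_card_nsmul _ _ 1 fun _ _ => Bool.toNat_le _).trans (by simp)

theorem sum_sum_range_min (f : ℕ → ℕ) (c m R : ℕ) :
    ∑ r ∈ Finset.range R, ∑ i ∈ Finset.range (min (c - r * m) m), f (r * m + i) =
      ∑ i ∈ Finset.range (min c (R * m)), f i := by
  induction R with
  | zero => simp
  | succ R ih =>
    rw [Finset.sum_range_succ, ih]
    have hs : (R + 1) * m = R * m + m := by ring
    rcases le_total c (R * m) with h | h
    · rw [Nat.sub_eq_zero_of_le h, min_eq_left h, min_eq_left (b := (R + 1) * m) (by omega)]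
      simp
    · rw [min_eq_right h, show min c ((R + 1) * m) = R * m + min (c - R * m) m by omega,
        Finset.sum_range_add]

/-- The binary digits of the number are the increments of `G` on the `m` steps from `k`. -/
def incrementBits (G : ℕ → ℕ) (m k : ℕ) : ℕ :=
  Nat.ofBits fun i : Fin m => decide (G (k + i) < G (k + i + 1))

/-- Increments are 0 or 1, so counting ones among the first `c` bits telescopes to `G (b + c) - G
b`. -/
theorem sum_bitCount_incrementBits {G : ℕ → ℕ} (hG : ∀ k, G k ≤ G (k + 1) ∧ G (k + 1) ≤ G k + 1)
    (b m R c : ℕ) (hc : c ≤ R * m) :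
    G b + ∑ r ∈ Finset.range R, bitCount (incrementBits G m (b + r * m)) (min (c - r * m) m) =
      G (b + c) := by
  have h1 (r i : ℕ) (hi : i ≤ m) : bitCount (incrementBits G m (b + r * m)) i =
      ∑ j ∈ Finset.range i, (G (b + (r * m + j) + 1) - G (b + (r * m + j))) := by
    refine Finset.sum_congr rfl fun j hj => ?_
    have hj' : j < m := (Finset.mem_range.1 hj).trans_le hi
    rw [incrementBits, Nat.testBit_ofBits_lt _ _ hj']
    simp only [add_assoc]
    obtain ⟨h1, h2⟩ := hG (b + (r * m + j))
    rw [add_assoc, add_assoc] at h1 h2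
    by_cases h : G (b + (r * m + j)) < G (b + (r * m + (j + 1)))
    · simp only [h, decide_true, Bool.toNat_true]; omega
    · simp only [h, decide_false, Bool.toNat_false]; omega
  rw [Finset.sum_congr rfl fun r _ => h1 r _ (min_le_right _ _),
    sum_sum_range_min (fun i => G (b + i + 1) - G (b + i)), min_eq_left hc]
  induction c with
  | zero => simp
  | succ c ih =>
    rw [Finset.sum_range_succ, ← add_assoc, ih (by omega)]
    have := hG (b + c)
    rw [← add_assoc]
    omega

/-- The points of `[0, 1)` that lie in the first three quarters of their cell of length `1 / K`. -/
def GoodSample (K : ℕ) : Type := {x : ℝ // 0 ≤ x ∧ x < 1 ∧ FloorGap 2 (K * x)}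

/-! ### Parameters and assembly of the network on good samples -/

theorem exists_exponent {w l j N R m K : ℕ} (hN : N = 2 ^ w) (hR : R = 2 ^ l) (hm : m = 2 ^ j)
    (hmw : m ≤ w) (hK : K = N * (N * (R * (m * R)))) :
    ∃ κ, K = 2 ^ κ ∧ κ + 2 ≤ 7 * R * w := by
  have hw : 1 ≤ w := (Nat.one_le_two_pow.trans hm.ge).trans hmw
  have hR0 : 1 ≤ R := by rw [hR]; exact Nat.one_le_two_pow
  have hlR : l < R := hR ▸ Nat.lt_two_pow_self
  have hjm : j < m := hm ▸ Nat.lt_two_pow_self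
  have hRw : R + w ≤ R * w + 1 := by nlinarith
  refine ⟨w + (w + (l + (j + l))), by rw [hK, hN, hR, hm]; simp only [pow_add], ?_⟩
  rw [mul_assoc]
  omega

-- Four digit extractions produce `p, q, r, c`; two table lookups give the block's starting value
-- and its packed increments; a digit sum adds the first `c` increments. The target is `4 H(z) - 2z
-- = F(2z) + 1` up to discretization, a quantity that is nonnegative and hence survives the ReLU.
set_option maxHeartbeats 4000000 in
theorem reach_goodSample {w l j N R m K : ℕ} (hN : N = 2 ^ w) (hR : R = 2 ^ l) (hm : m = 2 ^ j)
    (hmw : m ≤ w) (hK : K = N * (N * (R * (m * R)))) {G : ℕ → ℕ} (hGK : ∀ k, G k ≤ K)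
    (hG : ∀ k, G k ≤ G (k + 1) ∧ G (k + 1) ≤ G k + 1) {W : ℕ} (hW : 43 * N ≤ W) :
    Reach (7 * R * w) W (66 * R) (468 * R * w) (fun a : GoodSample K => a.1)
      fun a (_ : Unit) => max (4 * (G ⌊K * a.1⌋₊ / K : ℝ) - 2 * a.1) 0 := by
  have hw : 1 ≤ w := (Nat.one_le_two_pow.trans hm.ge).trans hmw
  have hN0 : 0 < N := by rw [hN]; positivity
  have hR0 : 0 < R := by rw [hR]; positivity
  have hm0 : 0 < m := by rw [hm]; positivity
  obtain ⟨B, hB⟩ : ∃ B, B = m * R := ⟨_, rfl⟩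
  obtain ⟨K₂, hK₂⟩ : ∃ K₂, K₂ = R * B := ⟨_, rfl⟩
  obtain ⟨K₁, hK₁⟩ : ∃ K₁, K₁ = N * K₂ := ⟨_, rfl⟩
  have hK' : K = N * K₁ := by rw [hK, hK₁, hK₂, hB]
  have hB0 : 0 < B := by rw [hB]; positivity
  have hK₂0 : 0 < K₂ := by rw [hK₂]; positivity
  have hK₁0 : 0 < K₁ := by rw [hK₁]; positivity
  have hK0 : 0 < K := by rw [hK']; positivity
  have hKR : (0 : ℝ) < K := by exact_mod_cast hK0
  obtain ⟨κ, hKκ, hκg⟩ := exists_exponent hN hR hm hmw hK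
  have hd : 4 * K ≤ 2 ^ (κ + 2) := by rw [hKκ, pow_add]; omega
  have hmN : 2 ^ m ≤ N := hN ▸ Nat.pow_le_pow_right two_pos hmw
  have hmN' : m < N := Nat.lt_two_pow_self.trans_le hmN
  -- `2^t = 64 N²` dominates every coefficient bound below, the largest being `(2^m + 1)(5m + 8)`
  -- with `2^m ≤ N` and `m < N`.
  obtain ⟨t, ht⟩ : ∃ t, t = 2 * w + 6 := ⟨_, rfl⟩
  have h2t : 2 ^ t = 64 * (N * N) := by rw [ht, hN]; ring
  have hNN : N ≤ N * N := Nat.le_mul_self N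
  let k : GoodSample K → ℕ := fun a => ⌊K * a.1⌋₊
  let f : GoodSample K → ℝ := fun a => K * a.1 - k a
  have hf₀ (a) : 0 ≤ f a := sub_nonneg.2 (Nat.floor_le a.2.2.2.1)
  have hf₁ (a) : f a ≤ 3 / 4 := by
    have := a.2.2.2.2
    simp only [f, k]
    norm_num at this
    linarith
  have hkK (a) : k a < K := by
    rw [Nat.floor_lt a.2.2.2.1]
    exact mul_lt_of_lt_one_right hKR a.2.2.1
  have s0 : Reach (7 * R * w) W 1 0 (fun a : GoodSample K => a.1) fun a (_ : Unit) => a.1 := by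
    refine ⟨0, le_rfl, (Realizes.input (7 * R * w + 0) W _ (fun _ : Unit => 1) (fun _ => 0)
      (fun _ => one_mem_unitGrid _) (fun _ => zero_mem_unitGrid _) (by simp; omega)).congr
      fun a _ => ?_⟩
    simpa using a.2.1
  -- The radices are `N, N, R, mR`. The first two digits are read in one round with width of order
  -- `N`, the last two in `R` rounds with small width.
  have s1 := s0.append_digit (iy := ()) hf₀ hf₁ (n := N) (R := 1) (K' := K₁) hK₁0 (by omega)
    (κ := k) (by simpa [hK'] using hkK)
    (fun a => by
      rw [mul_one, ← hK', eq_div_iff hKR.ne']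
      simp only [f]; ring)
    hκg (by rw [mul_one, ← hK']; exact hd) (t := t) (by omega) (by simp; omega)
  have s2 := s1.append_digit (iy := none) hf₀ hf₁ (n := N) (R := 1) (K' := K₂) hK₂0 (by omega)
    (κ := fun a => k a % K₁) (fun a => by rw [mul_one, ← hK₁]; exact Nat.mod_lt _ hK₁0)
    (fun a => by rw [mul_one, ← hK₁]; rfl)
    hκg (by rw [mul_one, ← hK₁]; nlinarith) (t := t) (by omega) (by simp; omega)
  have s3 := s2.append_digit (iy := none) hf₀ hf₁ (n := 1) (R := R) (K' := B) hB0 (by omega)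
    (κ := fun a => k a % K₁ % K₂) (fun a => by rw [one_mul, ← hK₂]; exact Nat.mod_lt _ hK₂0)
    (fun a => by rw [one_mul, ← hK₂]; rfl)
    hκg (by rw [one_mul, ← hK₂]; nlinarith) (t := t) (by omega) (by simp; omega)
  have s4 := s3.append_digit (iy := none) hf₀ hf₁ (n := m) (R := R) (K' := 1) one_pos (hB ▸ hB0)
    (κ := fun a => k a % K₁ % K₂ % B) (fun a => by rw [mul_one, ← hB]; exact Nat.mod_lt _ hB0)
    (fun a => by rw [mul_one, ← hB]; rfl)
    hκg (by rw [mul_one, ← hB]; nlinarith) (t := t) (by omega) (by simp; omega)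
  let p : GoodSample K → ℕ := fun a => k a / K₁
  let q : GoodSample K → ℕ := fun a => k a % K₁ / K₂
  let r : GoodSample K → ℕ := fun a => k a % K₁ % K₂ / B
  let c : GoodSample K → ℕ := fun a => k a % K₁ % K₂ % B / 1
  let b : GoodSample K → ℕ := fun a => ((p a * N + q a) * R + r a) * B
  have hp (a) : p a < N := Nat.div_lt_of_lt_mul (by rw [mul_comm, ← hK']; exact hkK a)
  have hq (a) : q a < N :=
    Nat.div_lt_of_lt_mul (by rw [mul_comm, ← hK₁]; exact Nat.mod_lt _ hK₁0)
  have hr (a) : r a < R :=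
    Nat.div_lt_of_lt_mul (by rw [mul_comm, ← hK₂]; exact Nat.mod_lt _ hK₂0)
  have hc (a) : c a < B := by simpa [c] using Nat.mod_lt _ hB0
  have hbc (a) : b a + c a = k a := by
    have h1 := Nat.div_add_mod (k a) K₁
    have h2 := Nat.div_add_mod (k a % K₁) K₂
    have h3 := Nat.div_add_mod (k a % K₁ % K₂) B
    have h4 : K₁ * p a = p a * N * R * B := by rw [hK₁, hK₂]; ring
    have h5 : K₂ * q a = q a * R * B := by rw [hK₂]; ring
    simp only [b, add_mul, ← h4, ← h5]
    simp only [p, q, r, c, Nat.div_one]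
    rw [mul_comm _ B]
    omega
  have s5 := s4.append_lookup₃ (p := p) (q := q) (c := r) (n := N) (R := R)
    (ip := some (some (some (some (some (some (some none)))))))
    (iq := some (some (some (some (some none))))) (ic := some (some (some none)))
    (fun _ => rfl) (fun _ => rfl) (fun _ => rfl) hp hq hr
    (fun r p q => digitVal m (fun i => incrementBits G m (((p * N + q) * R + r) * B + i * m)) R)
    (fun r _ p _ q _ => ⟨grid_mono (by nlinarith) (digitVal_mem_grid _ _ _),
      digitVal_nonneg _ _ _, (digitVal_le_half fun i _ => Nat.ofBits_lt_two_pow _).trans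
        (by norm_num)⟩) t (by omega) (by simp; omega)
  have s6 := s5.append_lookup₃ (p := p) (q := q) (c := r) (n := N) (R := R)
    (ip := some (some (some (some (some (some (some (some none))))))))
    (iq := some (some (some (some (some (some none)))))) (ic := some (some (some (some none))))
    (fun _ => rfl) (fun _ => rfl) (fun _ => rfl) hp hq hr
    (fun r p q => (G (((p * N + q) * R + r) * B) : ℝ) / K)
    (fun r _ p _ q _ => ⟨by
        rw [hKκ, Nat.cast_pow, Nat.cast_ofNat]
        exact grid_mono (by omega) (div_two_pow_mem_grid (natCast_mem_grid 0 _) κ),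
      by positivity, div_le_one_of_le₀ (by exact_mod_cast hGK _) hKR.le⟩) t (by omega)
    (by simp; omega)
  have s7 := s6.append_digit_sum (iθ := some none) (ic := some (some (some none))) (c := c)
    (D := fun a i => incrementBits G m (b a + i * m)) (m := m) (R := R) (fun _ => rfl)
    (fun _ => rfl) (fun _ _ _ => Nat.ofBits_lt_two_pow _) bitCount
    (fun _ _ i hi => (bitCount_le _ i).trans hi) (by nlinarith) t
    (by rw [h2t]; nlinarith) (by simp; omega)
  have hRw' : 1 ≤ R * w := Nat.mul_pos hR0 hw
  -- Output neuron: four times the tabulated starting value, plus `4 / K` times the bit count, minus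
  -- twice the input, which has been carried along since the first layer.
  refine (s7.layer t _ (by simp; omega) fun _ => ⟨fun a => 4 * (G (k a) / K : ℝ) - 2 * a.1,
    ((((Aff.coord (some none)).natCast_mul 4).add ((Aff.coord (g := 0) none).grid_mul
      (r := 4 / K) ?_)).sub ((Aff.coord
        (some (some (some (some (some (some (some (some (some (some (some ())))))))))))).natCast_mul
        2) |>.congr fun a => ?_).mono ?_, fun a => rfl⟩).mono ?_ ?_
  · rw [hKκ, Nat.cast_pow, Nat.cast_ofNat]
    exact grid_mono (by omega) (div_two_pow_mem_grid (natCast_mem_grid 0 4) κ)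
  · simp only [ext_none, ext_some]
    have := sum_bitCount_incrementBits hG (b a) m R (c a) (by rw [mul_comm, ← hB]; exact (hc a).le)
    rw [hbc] at this
    rw [← this]
    push_cast
    simp only [b]
    ring
  · have h1 : |(4 : ℝ) / K| ≤ 4 := by
      rw [abs_of_pos (by positivity), div_le_iff₀ hKR]
      have : (1 : ℝ) ≤ K := by exact_mod_cast hK0
      linarith
    have h2 : (64 : ℝ) ≤ 2 ^ t := by
      have : 64 ≤ 2 ^ t := by omega
      exact_mod_cast this
    push_cast
    linarith
  · omega
  · rw [ht]
    nlinarith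

/-! ### Parallel copies, medians and amplification -/

variable {α β ι : Type}

theorem Realizes.mono {b b' W W' k k' : ℕ} {inp : α → ℝ} {u : α → ι → ℝ}
    (h : Realizes b W k inp u) (hb : b ≤ b') (hW : W ≤ W') (hk : k ≤ k') :
    Realizes b' W' k' inp u := by
  obtain ⟨n, e, Φ, h1, h2, h3, h4⟩ := h
  exact ⟨n, e, Φ, h1.trans hk, h2.trans hW, h3.trans (unitGrid_mono hb), h4⟩

/-- Block-diagonal weights run one copy of `Φ` per index, all with the weights of `Φ`. -/
theorem Realizes.parallel {b W k : ℕ} {inp : α → ℝ} [Fintype ι] [Nonempty ι] {z : α → ι → ℝ}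
    (hz : Realizes b (Fintype.card ι * W) k inp z) {n : ℕ} (Φ : Config 1 n) (hW : Φ.width ≤ W)
    (hb : Φ.weights ⊆ unitGrid b) :
    Realizes b (Fintype.card ι * W) (k + Φ.depth) inp
      fun a (p : ι × Fin n) => max (Φ.realize (fun _ => z a p.1) p.2) 0 := by
  classical
  induction Φ with
  | @single n hd hd' A c =>
    have : Nonempty (Fin n) := ⟨⟨0, hd'⟩⟩
    refine (hz.layer le_rfl (fun (p : ι × Fin n) i => if p.1 = i then A p.2 0 else 0)
      (fun p => c p.2) (fun p i => ?_) (fun p => hb (.inr ⟨_, rfl⟩)) ?_).congr fun a p => ?_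
    · split_ifs
      exacts [hb (.inl ⟨(p.2, 0), rfl⟩), zero_mem_unitGrid b]
    · rw [Fintype.card_prod, Fintype.card_fin]
      exact Nat.mul_le_mul_left _ ((le_max_right _ _).trans hW)
    · simp [Config.realize, Matrix.mulVec, dotProduct]
  | @snoc m n Φ hd' A c ih =>
    have : Nonempty (Fin n) := ⟨⟨0, hd'⟩⟩
    refine ((ih ((le_max_left _ _).trans hW) (Set.subset_union_left.trans hb)).layer le_rfl
      (fun (p : ι × Fin n) (q : ι × Fin m) => if p.1 = q.1 then A p.2 q.2 else 0)
      (fun p => c p.2) (fun p q => ?_) (fun p => hb (.inr (.inr ⟨_, rfl⟩))) ?_).congr fun a p => ?_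
    · split_ifs
      exacts [hb (.inr (.inl ⟨(p.2, q.2), rfl⟩)), zero_mem_unitGrid b]
    · rw [Fintype.card_prod, Fintype.card_fin]
      exact Nat.mul_le_mul_left _ ((le_max_right _ _).trans hW)
    · simp [Config.realize, Matrix.mulVec, dotProduct, Fintype.sum_prod_type]

/-- Nothing is claimed where `z a i` is not an input of the given family: on bad samples the copy
outputs an uncontrolled value, which the median later discards. -/
theorem Reach.parallel [Fintype ι] [Nonempty ι] {g W k s : ℕ} {inp : α → ℝ} {inp' : β → ℝ}
    {y : β → Unit → ℝ} (h : Reach g W k s inp' y) {k' : ℕ} {z : α → ι → ℝ}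
    (hz : Realizes g (Fintype.card ι * W) k' inp z) :
    ∃ Y : α → ι → ℝ, Reach g (Fintype.card ι * W) (k' + k) s inp Y ∧
      ∀ a i x, z a i = inp' x → Y a i = y x () := by
  obtain ⟨s', hs', n, e, Φ, h1, h2, h3, h4⟩ := h
  refine ⟨fun a i => max (Φ.realize (fun _ => z a i) (e ())) 0 * 2 ^ s', ⟨s', hs', ?_⟩,
    fun a i x hx => ?_⟩
  · have hn : Unique (Fin n) := e.symm.unique
    obtain ⟨n', e', Φ', h1', h2', h3', h4'⟩ :=
      (hz.mono (Nat.le_add_right g s') le_rfl le_rfl).parallel Φ h2 h3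
    refine ⟨n', (Equiv.prodUnique ι (Fin n)).symm.trans e', Φ', h1'.trans (by omega), h2', h3',
      fun a i => ?_⟩
    dsimp only
    rw [mul_div_cancel_right₀ _ (by positivity)]
    exact (h4' a _).trans (congrArg (fun i' => max (Φ.realize (fun _ => z a i) i') 0)
      (Subsingleton.elim _ _))
  · dsimp only
    rw [hx, h4, div_mul_cancel₀ _ (by positivity)]

/-- The median of three numbers. -/
def median (y : Fin 3 → ℝ) : ℝ := max (min (y 0) (y 1)) (min (max (y 0) (y 1)) (y 2))

/-- With `d = max (y₀ - y₁) 0`, the maximum of `y₀, y₁` is `y₁ + d` and their minimum is `y₀ - d`;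
the other two comparisons are handled likewise, with one new neuron each. -/
theorem Reach.median {g W k s : ℕ} {inp : α → ℝ} {Y : α → Fin 3 → ℝ}
    (h : Reach g W k s inp Y) (hW : 6 ≤ W) :
    Reach g W (k + 4) (s + 12) inp fun a (_ : Unit) => median (Y a) := by
  have h0 (a : α) (i : Fin 3) := h.nonneg a i
  have e1 := h.append 3 (.relu ((Aff.coord 0).sub (.coord 1)) (by norm_num)) (by simp; omega)
  have e2 := e1.append 3 (.relu (((Aff.coord (some 1)).add (.coord none)).sub
    (.coord (some 2))) (by norm_num)) (by simp; omega)
  have e3 := e2.append 3 (.relu ((((Aff.coord (some (some 1))).add (.coord (some none))).sub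
    (.coord none)).sub ((Aff.coord (some (some 0))).sub (.coord (some none)))) (by norm_num))
    (by simp; omega)
  refine e3.layer 3 _ (by simp; omega) fun _ => .of_nonneg
    ((((Aff.coord (some (some (some 0)))).sub (.coord (some (some none)))).add
      (.coord none)).congr fun a => ?_) (by norm_num)
    fun a => le_max_of_le_left (le_min (h0 a 0) (h0 a 1))
  simp only [ext_none, ext_some, ReLUNet.median]
  rcases le_total (Y a 0) (Y a 1) with h1 | h1
  · rw [max_eq_right (sub_nonpos.2 h1), min_eq_left h1, max_eq_right h1, add_zero]
    rcases le_total (Y a 1) (Y a 2) with h2 | h2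
    · rw [max_eq_right (sub_nonpos.2 h2), min_eq_left h2, max_eq_left (by linarith),
        max_eq_right h1]
      ring
    · rw [max_eq_left (sub_nonneg.2 h2), min_eq_right h2]
      rcases le_total (Y a 0) (Y a 2) with h3 | h3
      · rw [max_eq_left (by linarith), max_eq_right h3]; ring
      · rw [max_eq_right (by linarith), max_eq_left h3]; ring
  · rw [max_eq_left (sub_nonneg.2 h1), min_eq_right h1, max_eq_left h1, add_sub_cancel]
    rcases le_total (Y a 0) (Y a 2) with h2 | h2
    · rw [max_eq_right (sub_nonpos.2 h2), min_eq_left h2, max_eq_left (by linarith),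
        max_eq_right h1]
      ring
    · rw [max_eq_left (sub_nonneg.2 h2), min_eq_right h2]
      rcases le_total (Y a 1) (Y a 2) with h3 | h3
      · rw [max_eq_left (by linarith), max_eq_right h3]; ring
      · rw [max_eq_right (by linarith), max_eq_left h3]; ring

/-- Weights of size at most 1 can still enlarge a value: adding `2^w` equal copies multiplies by
`2^w`, so `r` layers gain `2^{wr}`. The first layer contributes the correction `2^{s - wr} ≤ 1`,
which makes the total factor exactly `2^s`. -/
theorem Realizes.amplify {b W k w : ℕ} {inp : α → ℝ} {u : α → Unit → ℝ}
    (h : Realizes b W k inp u) (hW : 2 ^ w ≤ W) {s r : ℕ} (hs : s ≤ w * r) (hb : w * r ≤ b) :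
    Realizes b W (k + 1 + r) inp fun a (_ : Fin (2 ^ w)) => 2 ^ s * u a () := by
  have hne : Nonempty (Fin (2 ^ w)) := ⟨⟨0, by positivity⟩⟩
  have hu (a : α) : 0 ≤ u a () := by
    obtain ⟨n, e, Φ, -, -, -, h4⟩ := h
    rw [← h4]
    exact le_max_right _ _
  have key : ∀ i ≤ r, Realizes b W (k + 1 + i) inp
      fun a (_ : Fin (2 ^ w)) => 2 ^ (w * i) * (2 ^ s / 2 ^ (w * r)) * u a () := by
    intro i hi
    induction i with
    | zero =>
      refine (h.layer le_rfl (fun (_ : Fin (2 ^ w)) _ => (2 : ℝ) ^ s / 2 ^ (w * r)) (fun _ => 0)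
        (fun _ _ => ⟨?_, ?_⟩) (fun _ => zero_mem_unitGrid b) (by simpa using hW)).congr
        fun a _ => ?_
      · rw [abs_of_pos (by positivity)]
        exact div_le_one_of_le₀ (pow_le_pow_right₀ one_le_two hs) (by positivity)
      · have := div_two_pow_mem_grid (natCast_mem_grid 0 (2 ^ s)) (w * r)
        push_cast at this
        exact grid_mono (by omega) this
      · have := hu a
        simp only [Finset.univ_unique, Finset.sum_singleton, add_zero, mul_zero, pow_zero, one_mul]
        exact max_eq_left (by positivity)
    | succ i ih =>
      refine ((ih (by omega)).layer le_rfl (fun (_ : Fin (2 ^ w)) _ => 1) (fun _ => 0)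
        (fun _ _ => one_mem_unitGrid b) (fun _ => zero_mem_unitGrid b) (by simpa using hW)).congr
        fun a _ => ?_
      have := hu a
      rw [max_eq_left (by positivity)]
      simp only [one_mul, add_zero, Finset.sum_const, Finset.card_univ, Fintype.card_fin,
        nsmul_eq_mul, mul_add, mul_one, pow_add]
      push_cast
      ring
  refine (key r le_rfl).congr fun a _ => ?_
  field_simp

theorem Reach.exists_config {g W k s w r b : ℕ} {inp : α → ℝ} {y : α → Unit → ℝ}
    (h : Reach g W k s inp y) (hW : 2 ^ w ≤ W) (hs : s ≤ w * r) (hb : w * r ≤ b)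
    (hg : g + s ≤ b) :
    ∃ Φ : Config 1 1, Φ.depth ≤ k + r + 2 ∧ Φ.width ≤ W ∧ Φ.weights ⊆ unitGrid b ∧
      ∀ a, Φ.realize (fun _ => inp a) 0 = y a () - 1 := by
  obtain ⟨s', hs', hR⟩ := h
  obtain ⟨n, e, Φ, h1, h2, h3, h4⟩ :=
    (hR.mono (by omega) le_rfl le_rfl).amplify hW (s := s') (by omega) hb
  have h1W : 1 ≤ W := Nat.one_le_two_pow.trans hW
  let i₀ : Fin n := e ⟨0, by positivity⟩
  refine ⟨.snoc Φ one_pos (fun _ i => if i = i₀ then 1 else 0) fun _ => -1,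
    by simp only [Config.depth]; omega, by simp only [Config.width]; exact max_le h2 h1W, ?_,
    fun a => ?_⟩
  · rintro _ (hr | ⟨p, rfl⟩ | ⟨j, rfl⟩)
    · exact h3 hr
    · dsimp only
      split_ifs
      exacts [one_mem_unitGrid b, zero_mem_unitGrid b]
    · exact neg_mem_unitGrid (one_mem_unitGrid b)
  · simp only [Config.realize, Matrix.mulVec, dotProduct, Pi.add_apply, ite_mul, one_mul, zero_mul,
      Finset.sum_ite_eq', Finset.mem_univ, if_true]
    rw [h4]
    dsimp only
    rw [mul_div_cancel₀ _ (by positivity), sub_eq_add_neg]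

/-! ### Approximation of Lipschitz functions -/

theorem median_mem_Icc {y : Fin 3 → ℝ} {lo hi : ℝ} {i j : Fin 3} (hij : i ≠ j)
    (hi' : y i ∈ Set.Icc lo hi) (hj : y j ∈ Set.Icc lo hi) : median y ∈ Set.Icc lo hi := by
  have h : (y 0 ∈ Set.Icc lo hi ∧ y 1 ∈ Set.Icc lo hi) ∨
      (y 0 ∈ Set.Icc lo hi ∧ y 2 ∈ Set.Icc lo hi) ∨
      (y 1 ∈ Set.Icc lo hi ∧ y 2 ∈ Set.Icc lo hi) := by
    fin_cases i <;> fin_cases j <;> simp_all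
  simp only [Set.mem_Icc] at h ⊢
  simp only [median, le_max_iff, le_min_iff, max_le_iff, min_le_iff]
  rcases h with ⟨⟨h1, h2⟩, h3, h4⟩ | ⟨⟨h1, h2⟩, h3, h4⟩ | ⟨⟨h1, h2⟩, h3, h4⟩
  · exact ⟨.inl ⟨h1, h3⟩, .inl h2, .inl ⟨h2, h4⟩⟩
  · exact ⟨.inr ⟨.inl h1, h3⟩, .inl h2, .inr h4⟩
  · exact ⟨.inr ⟨.inr h1, h3⟩, .inr h2, .inr h4⟩

theorem floorGap_natCast_add {n : ℕ} {e : ℝ} (he₀ : 0 ≤ e) (he₁ : e ≤ 3 / 4) :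
    FloorGap 2 (n + e) := by
  simpa using floorGap_add_div (k := n) he₀ he₁ one_pos (d := 2) (by norm_num)

/-- Of three numbers at distance `1 / 4`, at most one has its fractional part above `3 / 4`. -/
theorem exists_two_floorGap {u : ℝ} (hu : 0 ≤ u) :
    ∃ i j : Fin 3, i ≠ j ∧ FloorGap 2 (u + (i : ℕ) / 4) ∧ FloorGap 2 (u + (j : ℕ) / 4) := by
  have h1 := Nat.floor_le hu
  have h2 := Nat.lt_floor_add_one u
  have key (i : ℕ) (n : ℕ) (h : (n : ℝ) ≤ u + i / 4) (h' : u + i / 4 - n ≤ 3 / 4) :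
      FloorGap 2 (u + i / 4) := by
    have := floorGap_natCast_add (n := n) (sub_nonneg.2 h) h'
    rwa [add_sub_cancel] at this
  rcases le_total (u - ⌊u⌋₊) (1 / 2) with h | h
  · exact ⟨0, 1, by decide, key _ ⌊u⌋₊ (by simpa using h1) (by simp; linarith),
      key _ ⌊u⌋₊ (by norm_num; linarith) (by norm_num; linarith)⟩
  rcases le_total (u - ⌊u⌋₊) (3 / 4) with h' | h'
  · exact ⟨0, 2, by decide, key _ ⌊u⌋₊ (by simpa using h1) (by norm_num; linarith),
      key _ (⌊u⌋₊ + 1) (by norm_num; linarith) (by norm_num; linarith)⟩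
  · exact ⟨1, 2, by decide, key _ (⌊u⌋₊ + 1) (by norm_num; linarith) (by norm_num; linarith),
      key _ (⌊u⌋₊ + 1) (by norm_num; linarith) (by norm_num; linarith)⟩

/-- Discretization of a monotone `1`-Lipschitz function with values in `[0, 1]`. -/
theorem exists_discretization {H : ℝ → ℝ} (hH₀ : ∀ z, 0 ≤ z → 0 ≤ H z) (hmono : Monotone H)
    (hlip : ∀ x y, x ≤ y → H y - H x ≤ y - x) {K : ℕ} (hK : 0 < K) :
    ∃ G : ℕ → ℕ, (∀ k, G k ≤ K) ∧ (∀ k, G k ≤ G (k + 1) ∧ G (k + 1) ≤ G k + 1) ∧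
      ∀ z, 0 ≤ z → H z ≤ 1 → |(G ⌊K * z⌋₊ / K : ℝ) - H z| ≤ 2 / K := by
  have hK' : (0 : ℝ) < K := by exact_mod_cast hK
  have hm (k : ℕ) : H (k / K) ≤ H ((k + 1 : ℕ) / K) :=
    hmono (by gcongr; exact Nat.le_succ k)
  have hl (k : ℕ) : K * H ((k + 1 : ℕ) / K) ≤ K * H (k / K) + 1 := by
    have := mul_le_mul_of_nonneg_left (hlip (k / K) ((k + 1 : ℕ) / K)
      (by gcongr; exact Nat.le_succ k)) hK'.le
    have h2 : (K : ℝ) * ((k + 1 : ℕ) / K - k / K) = 1 := by push_cast; field_simp; ring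
    linarith
  -- The cap at `K` is needed since `H` may exceed 1 far out. A sequence growing by between 0 and 1
  -- per step has integer parts growing by 0 or 1.
  refine ⟨fun k => ⌊min (K * H (k / K)) K⌋₊, fun k => ?_, fun k => ⟨?_, ?_⟩, fun z hz hz1 => ?_⟩
  · exact Nat.floor_le_of_le (min_le_right _ _)
  · exact Nat.floor_mono (min_le_min_right _ (mul_le_mul_of_nonneg_left (hm k) hK'.le))
  · dsimp only
    rw [← Nat.floor_add_one (le_min (mul_nonneg hK'.le (hH₀ _ (by positivity))) hK'.le)]
    refine Nat.floor_mono ?_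
    rw [← min_add_add_right]
    exact min_le_min (hl k) (by linarith)
  · have hKz : 0 ≤ K * z := by positivity
    have h1 := Nat.floor_le hKz
    have h2 := (Nat.lt_floor_add_one (K * z)).le
    set k := ⌊K * z⌋₊
    have hle : (k : ℝ) / K ≤ z := by rwa [div_le_iff₀ hK', mul_comm]
    have h3 := hmono hle
    have h4 := hlip _ _ hle
    have h5 : z - k / K ≤ 1 / K := by
      rw [sub_le_iff_le_add, ← add_div, le_div_iff₀ hK', mul_comm]; linarith
    dsimp only
    rw [min_eq_left (mul_le_of_le_one_right hK'.le (h3.trans hz1))]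
    have h6 := Nat.floor_le (mul_nonneg hK'.le (hH₀ (k / K) (by positivity)))
    have h7 := (Nat.lt_floor_add_one (K * H (k / K))).le
    have h8 : (⌊K * H (k / K)⌋₊ : ℝ) / K ≤ H (k / K) := by
      rwa [div_le_iff₀ hK', mul_comm (H _)]
    have h9 : H (k / K) ≤ (⌊K * H (k / K)⌋₊ : ℝ) / K + 1 / K := by
      rw [← add_div, le_div_iff₀ hK', mul_comm]; exact h7
    have h10 : (2 : ℝ) / K = 1 / K + 1 / K := by ring
    rw [abs_le, h10]
    have h11 : (0 : ℝ) ≤ 1 / K := by positivity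
    constructor <;> linarith

/-- The network for good samples is run at `x/2 + i/(4K)`, `i = 0, 1, 2`. Halving `x` leaves room
for the shifts inside `[0,1)`, and at least two shifts land in good parts of their cells. -/
theorem exists_config_approx {w l j N R m K : ℕ} (hN : N = 2 ^ w) (hR : R = 2 ^ l)
    (hm : m = 2 ^ j) (hmw : m ≤ w) (hK : K = N * (N * (R * (m * R)))) {F : ℝ → ℝ}
    (hF : ∀ x, |F x| ≤ 1) (hFlip : ∀ x y, |F x - F y| ≤ |x - y|) :
    ∃ Φ : Config 1 1, Φ.depth ≤ 554 * R ∧ Φ.width ≤ 129 * N ∧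
      Φ.weights ⊆ unitGrid (487 * R * w) ∧
      ∀ x, 0 ≤ x → x ≤ 1 → |Φ.realize (fun _ => x) 0 - F x| ≤ 9 / K := by
  have hw : 1 ≤ w := (Nat.one_le_two_pow.trans hm.ge).trans hmw
  have hN2 : 2 ≤ N := by rw [hN]; exact Nat.le_self_pow (by omega) 2
  have hR0 : 0 < R := by rw [hR]; positivity
  have hm0 : 0 < m := by rw [hm]; positivity
  have hRw : 1 ≤ R * w := Nat.mul_pos hR0 hw
  obtain ⟨κ, hKκ, hκg⟩ := exists_exponent hN hR hm hmw hK
  have hK2 : 2 ≤ K := by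
    rw [hK]
    exact hN2.trans (Nat.le_mul_of_pos_right _ (by positivity))
  have hKR : (2 : ℝ) ≤ K := by exact_mod_cast hK2
  have hK0 : (0 : ℝ) < K := by linarith
  have hFl (x y : ℝ) (h : x ≤ y) : |F y - F x| ≤ y - x := by
    rw [← abs_of_nonneg (sub_nonneg.2 h)]; exact hFlip y x
  -- Since `z ↦ F(2z)` is 2-Lipschitz, adding `2z` makes it monotone with slopes in `[0,4]`;
  -- dividing by 4 gives slopes in `[0,1]`.
  obtain ⟨G, hGK, hG, hGH⟩ := exists_discretization (H := fun z => (F (2 * z) + 1 + 2 * z) / 4)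
    (fun z hz => by have := abs_le.1 (hF (2 * z)); linarith)
    (fun x y h => by have := abs_le.1 (hFl (2 * x) (2 * y) (by linarith)); dsimp only; linarith)
    (fun x y h => by have := abs_le.1 (hFl (2 * x) (2 * y) (by linarith)); linarith)
    (by omega : 0 < K)
  let z : Set.Icc (0 : ℝ) 1 → Fin 3 → ℝ := fun x i => x / 2 + (i : ℕ) / (4 * K)
  have hi (i : Fin 3) : ((i : ℕ) : ℝ) ≤ 2 := by exact_mod_cast Nat.le_of_lt_succ i.2
  have h4K (i : Fin 3) : ((i : ℕ) : ℝ) / (4 * K) ≤ 1 / 2 / K := by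
    rw [div_div, div_le_div_iff₀ (by positivity) (by positivity)]
    nlinarith [hi i]
  have hK' : 1 / 2 / (K : ℝ) ≤ 1 / 4 := by
    rw [div_le_iff₀ hK0]; linarith
  have hz0 (x i) : 0 ≤ z x i := add_nonneg (by linarith [x.2.1]) (by positivity)
  have hz1 (x i) : z x i < 1 := by linarith [x.2.2, h4K i, show z x i = x / 2 + _ from rfl]
  have hz : Realizes (7 * R * w) (Fintype.card (Fin 3) * (43 * N)) 1
      (fun x : Set.Icc (0 : ℝ) 1 => (x : ℝ)) z := by
    refine (Realizes.input (7 * R * w) _ _ (fun _ : Fin 3 => 1 / 2)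
      (fun i => (i : ℕ) / (4 * K)) (fun _ => ⟨?_, ?_⟩) (fun i => ⟨?_, ?_⟩) (by simp; omega)).congr
      fun x i => ?_
    · rw [abs_of_pos] <;> norm_num
    · have := div_two_pow_mem_grid (one_mem_grid 0) 1
      rw [pow_one] at this
      exact grid_mono (by omega) this
    · rw [abs_of_nonneg (by positivity)]
      linarith [h4K i]
    · have := div_two_pow_mem_grid (natCast_mem_grid 0 i) (κ + 2)
      rw [show ((i : ℕ) : ℝ) / (4 * K) = (i : ℕ) / 2 ^ (κ + 2) by
        rw [hKκ, Nat.cast_pow, pow_add]; norm_num [mul_comm]]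
      exact grid_mono (by omega) this
    · rw [max_eq_left]
      · simp only [z]; ring
      · have := hz0 x i
        simp only [z] at this
        linarith
  obtain ⟨Y, hY, hYz⟩ := (reach_goodSample hN hR hm hmw hK hGK hG le_rfl).parallel hz
  have hW : 6 ≤ Fintype.card (Fin 3) * (43 * N) := by simp; omega
  -- The scale `468Rw + 12` is at most `480Rw`, so `480R` amplifying layers suffice; the precision
  -- is `7Rw + 480Rw`.
  obtain ⟨Φ, h1, h2, h3, h4⟩ := (hY.median hW).exists_config (w := w) (r := 480 * R)
    (b := 487 * R * w) (by rw [← hN]; simp; omega) (by nlinarith) (by nlinarith) (by nlinarith)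
  refine ⟨Φ, by omega, h2.trans (by simp; omega), h3, fun x hx0 hx1 => ?_⟩
  have hYF (i : Fin 3) (hgap : FloorGap 2 (K * (x / 2) + (i : ℕ) / 4)) :
      Y ⟨x, hx0, hx1⟩ i ∈ Set.Icc (F x + 1 - 9 / K) (F x + 1 + 9 / K) := by
    have hKz : K * z ⟨x, hx0, hx1⟩ i = K * (x / 2) + (i : ℕ) / 4 := by
      simp only [z]; field_simp
    have hz0' := hz0 ⟨x, hx0, hx1⟩ i
    rw [hYz _ i ⟨z ⟨x, hx0, hx1⟩ i, hz0', hz1 _ _, hKz ▸ hgap⟩ rfl]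
    have hzx : z ⟨x, hx0, hx1⟩ i - x / 2 ≤ 1 / 2 / K := by
      simp only [z]; linarith [h4K i]
    have hzx' : x / 2 ≤ z ⟨x, hx0, hx1⟩ i := by
      simp only [z]; linarith [show (0 : ℝ) ≤ (i : ℕ) / (4 * K) by positivity]
    set y := z ⟨x, hx0, hx1⟩ i
    dsimp only
    have e1 := abs_le.1 (hF (2 * y))
    have e2 := abs_le.1 (hFl x (2 * y) (by linarith))
    have e3 := abs_le.1 (hGH y hz0' (by linarith [hz1 ⟨x, hx0, hx1⟩ i]))
    -- The discretization error `2/K` is magnified by 4; the shift moves `2y` away from `x` by at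
    -- most `1/K`.
    have e4 : (9 : ℝ) / K = 4 * (2 / K) + 2 * (1 / 2 / K) := by ring
    have e5 : (0 : ℝ) ≤ 1 / 2 / K := by positivity
    have e6 := abs_le.1 (hF x)
    rw [e4]
    exact ⟨le_max_of_le_left (by linarith), max_le (by linarith) (by linarith)⟩
  obtain ⟨i, j, hij, hgi, hgj⟩ := exists_two_floorGap (u := K * (x / 2)) (by positivity)
  have := median_mem_Icc hij (hYF i hgi) (hYF j hgj)
  rw [h4 ⟨x, hx0, hx1⟩, abs_le]
  constructor <;> linarith [this.1, this.2]

/-! ### A lower bound on the minimax code length -/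

/-- The points `i / n` with `σ i = true`, together with a point far away from `[0, 1]`. -/
def markedPoints {n : ℕ} (σ : Fin n → Bool) : Set ℝ :=
  insert 5 {c | ∃ i, σ i = true ∧ c = (i : ℕ) / n}

/-- The truncated distance to the marked points. -/
def packingFunction {n : ℕ} (σ : Fin n → Bool) : LInfty :=
  ⟨fun x => min 1 (Metric.infDist (x : ℝ) (markedPoints σ)), memℓp_infty ⟨1, by
    rintro _ ⟨x, rfl⟩
    dsimp only
    rw [Real.norm_of_nonneg (le_min zero_le_one Metric.infDist_nonneg)]
    exact min_le_left _ _⟩⟩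

theorem packingFunction_apply {n : ℕ} (σ : Fin n → Bool) (x : Set.Icc (0 : ℝ) 1) :
    packingFunction σ x = min 1 (Metric.infDist (x : ℝ) (markedPoints σ)) := rfl

theorem packingFunction_mem_lipUnit {n : ℕ} (σ : Fin n → Bool) :
    packingFunction σ ∈ lipUnit := by
  refine ⟨?_, fun x => ?_, fun x y => ?_⟩
  · exact continuous_const.min ((Metric.continuous_infDist_pt _).comp continuous_subtype_val)
  · rw [packingFunction_apply, abs_of_nonneg (le_min zero_le_one Metric.infDist_nonneg)]
    exact min_le_left _ _
  · rw [packingFunction_apply, packingFunction_apply]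
    refine (abs_min_sub_min_le_max _ _ _ _).trans ?_
    rw [sub_self, abs_zero, max_eq_right (abs_nonneg _)]
    simpa [Real.dist_eq] using (Metric.lipschitz_infDist_pt (markedPoints σ)).dist_le_mul (x : ℝ) y

theorem one_div_le_dist_packingFunction {n : ℕ} {σ τ : Fin n → Bool} {i : Fin n}
    (hσ : σ i = true) (hτ : τ i = false) :
    1 / n ≤ dist (packingFunction σ) (packingFunction τ) := by
  have hn : 0 < n := i.pos
  have hn' : (0 : ℝ) < n := by exact_mod_cast hn
  have hin : ((i : ℕ) : ℝ) ≤ n := by exact_mod_cast i.2.le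
  let x : Set.Icc (0 : ℝ) 1 := ⟨(i : ℕ) / n, by positivity, div_le_one_of_le₀ hin hn'.le⟩
  have h1 : packingFunction σ x = 0 := by
    rw [packingFunction_apply, Metric.infDist_zero_of_mem (.inr ⟨i, hσ, rfl⟩),
      min_eq_right zero_le_one]
  have h2 : 1 / n ≤ packingFunction τ x := by
    have h1n : 1 / (n : ℝ) ≤ 1 := div_le_one_of_le₀ (by exact_mod_cast hn) hn'.le
    rw [packingFunction_apply]
    -- `Metric.infDist` to the empty set is 0; the marked point 5 rules this out, and it is too far
    -- from `[0,1]` to matter under the truncation at 1.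
    refine le_min h1n ((Metric.le_infDist ⟨5, .inl rfl⟩).2 ?_)
    rintro _ (rfl | ⟨j, hj, rfl⟩)
    · rw [Real.dist_eq, abs_sub_comm]
      exact le_trans (by linarith [x.2.2]) (le_abs_self _)
    · have hij : (i : ℤ) - (j : ℕ) ≠ 0 := fun h => by
        have : i = j := Fin.ext (by omega)
        rw [this, hj] at hτ
        exact absurd hτ (by simp)
      have h1 : (1 : ℝ) ≤ |((i : ℕ) : ℝ) - (j : ℕ)| := by
        exact_mod_cast Int.one_le_abs hij
      rw [Real.dist_eq, show (x : ℝ) - (j : ℕ) / n = (((i : ℕ) : ℝ) - (j : ℕ)) / n by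
        simp only [x]; ring, abs_div, abs_of_pos hn']
      gcongr
  rw [dist_comm, dist_eq_norm]
  refine le_trans ?_ (lp.norm_apply_le_norm ENNReal.top_ne_zero _ x)
  rw [lp.coeFn_sub, Pi.sub_apply, h1, sub_zero]
  exact h2.trans (le_abs_self _)

/-- Two packing functions with the same code would lie within `2e < 1/n` of each other. Hence the
encoder is injective on `2^n` functions. -/
theorem le_minimaxCodeLength {n : ℕ} {e : ℝ} {ε : ℝ≥0∞} (hε : ε ≤ ENNReal.ofReal e)
    (he : 0 ≤ e) (hn : 2 * e < 1 / n) : (n : ℕ∞) ≤ minimaxCodeLength ε lipUnit := by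
  refine le_iInf₂ fun ℓ hℓ => ?_
  obtain ⟨E, D, hED⟩ := hℓ
  have hd (f : lipUnit) : dist (f : LInfty) (D (E f)) ≤ e := by
    have := ((le_iSup (fun y : lipUnit => edist (y : LInfty) (D (E y))) f).trans hED).trans hε
    rwa [edist_dist, ENNReal.ofReal_le_ofReal_iff he] at this
  let F : (Fin n → Bool) → lipUnit := fun σ => ⟨packingFunction σ, packingFunction_mem_lipUnit σ⟩
  have hinj : Function.Injective fun σ => E (F σ) := by
    intro σ τ h
    by_contra hne
    obtain ⟨i, hi⟩ := Function.ne_iff.1 hne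
    have h1 : dist (packingFunction σ) (packingFunction τ) ≤ 2 * e := by
      have h2 := hd (F σ)
      have h3 := hd (F τ)
      rw [show E (F σ) = E (F τ) from h] at h2
      exact (dist_triangle_right _ _ _).trans (by rw [two_mul]; exact add_le_add h2 h3)
    cases hσ : σ i <;> cases hτ : τ i
    · exact hi (hσ.trans hτ.symm)
    · rw [dist_comm] at h1
      exact absurd (one_div_le_dist_packingFunction hτ hσ) (by linarith)
    · exact absurd (one_div_le_dist_packingFunction hσ hτ) (by linarith)
    · exact hi (hσ.trans hτ.symm)
  have := Fintype.card_le_of_injective _ hinj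
  simp only [Fintype.card_fun, Fintype.card_bool, Fintype.card_fin] at this
  exact_mod_cast (Nat.pow_le_pow_iff_right one_lt_two).1 this

/-! ### Counting configurations -/

theorem exists_finset_quantized (b : ℕ) :
    ∃ S : Finset ℝ, quantized 1 b ⊆ S ∧ S.card ≤ 2 ^ (b + 3) := by
  classical
  refine ⟨(Finset.Ioo (-2 ^ (b + 2) : ℤ) (2 ^ (b + 2))).image fun k : ℤ => (k : ℝ) / 2 ^ b, ?_, ?_⟩
  · rintro _ ⟨⟨h1, h2⟩, k, rfl⟩
    have hb : (0 : ℝ) < 2 ^ b := by positivity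
    dsimp only at h1 h2
    rw [lt_div_iff₀ hb] at h1
    rw [div_lt_iff₀ hb] at h2
    norm_num at h1 h2
    refine Finset.mem_coe.2 (Finset.mem_image.2 ⟨k, Finset.mem_Ioo.2 ⟨?_, ?_⟩, rfl⟩)
    · have : ((-2 ^ (b + 2) : ℤ) : ℝ) < k := by
        push_cast
        rw [pow_add]
        norm_num
        linarith
      exact_mod_cast this
    · have : (k : ℝ) < ((2 ^ (b + 2) : ℤ) : ℝ) := by
        push_cast
        rw [pow_add]
        norm_num
        linarith
      exact_mod_cast this
  · refine Finset.card_image_le.trans ?_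
    rw [Int.card_Ioo, Int.toNat_le]
    push_cast
    rw [pow_add, pow_add]
    linarith [pow_pos (two_pos : (0 : ℤ) < 2) b]

theorem exists_finset_layer (S : Finset ℝ) (n m : ℕ) :
    ∃ T : Finset ((Fin n → Fin m → ℝ) × (Fin n → ℝ)), T.card = S.card ^ (n * m + n) ∧
      ∀ A b, ((Set.range fun p : Fin n × Fin m => A p.1 p.2) ∪ Set.range b) ⊆ (S : Set ℝ) →
        (A, b) ∈ T := by
  classical
  refine ⟨(Fintype.piFinset fun _ : Fin n => Fintype.piFinset fun _ : Fin m => S) ×ˢ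
    Fintype.piFinset fun _ : Fin n => S, ?_, fun A b h => ?_⟩
  · rw [Finset.card_product]
    simp [Fintype.card_piFinset, pow_add, ← pow_mul, mul_comm]
  · refine Finset.mem_product.2 ⟨Fintype.mem_piFinset.2 fun i => Fintype.mem_piFinset.2 fun j =>
      h (.inl ⟨(i, j), rfl⟩), Fintype.mem_piFinset.2 fun i => h (.inr ⟨i, rfl⟩)⟩

/-- Recursion on depth: a configuration is a single layer, or a shallower one of some output width
`m ≤ W` followed by a layer with at most `W² + W` entries. The factor `W + 2` covers the `W + 1`
values of `m` and the single-layer case. -/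
theorem exists_finset_configs (S : Finset ℝ) (hS : 0 < S.card) (W k n : ℕ) (hn : n ≤ W) :
    ∃ F : Finset (Config 1 n), configs (S : Set ℝ) 1 n W k ⊆ F ∧
      F.card ≤ ((W + 2) * S.card ^ (W * W + W)) ^ k := by
  classical
  induction k generalizing n with
  | zero =>
    refine ⟨∅, fun Φ hΦ => ?_, by simp⟩
    have := hΦ.2.1
    cases Φ <;> simp [Config.depth] at this
  | succ k ih =>
    choose! F hF hFc using ih
    choose T hTc hT using exists_finset_layer S n
    set P := (W + 2) * S.card ^ (W * W + W) with hP
    have hP1 : 1 ≤ P ^ k := Nat.one_le_pow _ _ (by positivity)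
    have hTP (m : ℕ) (hm : m ≤ W) : (T m).card ≤ S.card ^ (W * W + W) := by
      rw [hTc]
      exact Nat.pow_le_pow_right hS (by nlinarith)
    -- Building a configuration requires a proof of `0 < n`; `Option` absorbs the case `n = 0`.
    let single : (Fin n → Fin 1 → ℝ) × (Fin n → ℝ) → Option (Config 1 n) := fun p =>
      if h : 0 < n then some (.single one_pos h p.1 p.2) else none
    let snoc (m : ℕ) : Config 1 m × ((Fin n → Fin m → ℝ) × (Fin n → ℝ)) →
        Option (Config 1 n) := fun p =>
      if h : 0 < n then some (.snoc p.1 h p.2.1 p.2.2) else none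
    let U : Finset (Option (Config 1 n)) := (T 1).image single ∪
      (Finset.range (W + 1)).biUnion fun m => (F m ×ˢ T m).image (snoc m)
    refine ⟨Finset.eraseNone U, ?_, ?_⟩
    · rintro Φ ⟨h1, h2, h3⟩
      refine Finset.mem_coe.2 (Finset.mem_eraseNone.2 (Finset.mem_union.2 ?_))
      cases Φ with
      | single hd hd' A b =>
        exact .inl (Finset.mem_image.2 ⟨(A, b), hT 1 A b h3, by simp [single, hd']⟩)
      | @snoc m n Φ hd' A b =>
        have hΦ : Φ.width ≤ W := (le_max_left _ _).trans h1
        have hm : m ≤ W := by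
          refine le_trans ?_ hΦ
          cases Φ <;> exact le_max_right _ _
        refine .inr (Finset.mem_biUnion.2 ⟨m, Finset.mem_range.2 (by omega),
          Finset.mem_image.2 ⟨(Φ, A, b), Finset.mem_product.2 ⟨hF m hm ⟨hΦ,
            Nat.le_of_succ_le_succ h2, Set.subset_union_left.trans h3⟩,
            hT m A b (Set.subset_union_right.trans h3)⟩, by simp [snoc, hd']⟩⟩)
    · have hU : U.card ≤ S.card ^ (W * W + W) +
          (W + 1) * (P ^ k * S.card ^ (W * W + W)) := by
        refine (Finset.card_union_le _ _).trans (add_le_add ?_ ?_)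
        · rcases Nat.eq_zero_or_pos W with rfl | hW
          · obtain rfl : n = 0 := by omega
            refine Finset.card_image_le.trans ?_
            rw [hTc]
          · exact Finset.card_image_le.trans (hTP 1 hW)
        · refine Finset.card_biUnion_le.trans ?_
          refine (Finset.sum_le_card_nsmul _ _ (P ^ k * S.card ^ (W * W + W)) fun m hm => ?_).trans
            (by simp)
          have hm' : m ≤ W := Nat.le_of_lt_succ (Finset.mem_range.1 hm)
          refine Finset.card_image_le.trans ?_
          rw [Finset.card_product]
          exact Nat.mul_le_mul (hFc m hm') (hTP m hm')
      refine (Finset.card_eraseNone_le _).trans (hU.trans ?_)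
      rw [pow_succ]
      calc _ ≤ P ^ k * S.card ^ (W * W + W) + (W + 1) * (P ^ k * S.card ^ (W * W + W)) := by
            gcongr
            exact Nat.le_mul_of_pos_left _ hP1
        _ = P ^ k * P := by rw [hP]; ring

theorem quantizedRealizations_finite_and_log_le {b W L : ℕ} (hb : 1 ≤ b) (hW : 2 ≤ W) :
    (quantizedRealizations 1 b W L).Finite ∧
      ⌈Real.logb 2 ((quantizedRealizations 1 b W L).ncard : ℝ)⌉₊ ≤ 9 * W ^ 2 * L * b := by
  classical
  obtain ⟨S, hS, hSc⟩ := exists_finset_quantized b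
  have hS0 : 0 < S.card := Finset.card_pos.2 ⟨0, hS
    (unitGrid_subset_quantized b (zero_mem_unitGrid b))⟩
  obtain ⟨F, hF, hFc⟩ := exists_finset_configs S hS0 W L 1 (by omega)
  have hsub : quantizedRealizations 1 b W L ⊆ (F.image Config.toLInfty : Finset LInfty) := by
    rintro _ ⟨Φ, hΦ, rfl⟩
    exact Finset.mem_coe.2 (Finset.mem_image_of_mem _ (hF ⟨hΦ.1, hΦ.2.1, hΦ.2.2.trans hS⟩))
  refine ⟨(Finset.finite_toSet _).subset hsub, ?_⟩
  have hcard : (quantizedRealizations 1 b W L).ncard ≤ 2 ^ (9 * W ^ 2 * L * b) := by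
    refine (Set.ncard_le_ncard hsub (Finset.finite_toSet _)).trans ?_
    rw [Set.ncard_coe_finset]
    refine Finset.card_image_le.trans (hFc.trans ?_)
    calc _ ≤ (2 ^ (W + 2) * (2 ^ (b + 3)) ^ (W * W + W)) ^ L := by
          gcongr
          exact Nat.lt_two_pow_self.le
      _ = 2 ^ ((W + 2 + (b + 3) * (W * W + W)) * L) := by
          rw [← pow_mul, ← pow_add, ← pow_mul]
      _ ≤ 2 ^ (9 * W ^ 2 * L * b) := by
          refine Nat.pow_le_pow_right two_pos ?_
          rw [show 9 * W ^ 2 * L * b = 9 * W ^ 2 * b * L by ring]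
          refine Nat.mul_le_mul_right _ ?_
          have h1 : W + 2 ≤ W ^ 2 * b := by nlinarith [Nat.mul_le_mul_left (W ^ 2) hb]
          have h2 : (b + 3) * (W * W + W) ≤ (4 * b) * (2 * W ^ 2) :=
            Nat.mul_le_mul (by omega) (by nlinarith)
          linarith
  refine Nat.ceil_le.2 ?_
  rcases Nat.eq_zero_or_pos (quantizedRealizations 1 b W L).ncard with h0 | h0
  · rw [h0]; simp; positivity
  · rw [Real.logb_le_iff_le_rpow one_lt_two (by exact_mod_cast h0), Real.rpow_natCast]
    exact_mod_cast hcard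

/-! ### The approximation error and memory optimality -/

theorem exists_two_pow_le_lt {n : ℕ} (hn : 1 ≤ n) : ∃ l, 2 ^ l ≤ n ∧ n < 2 * 2 ^ l :=
  ⟨Nat.log 2 n, Nat.pow_log_le_self 2 (by omega), by
    rw [← pow_succ']; exact Nat.lt_pow_succ_log_self one_lt_two n⟩

theorem exists_two_pow_mul_le_lt {c n : ℕ} (hc : 0 < c) (hn : c ≤ n) :
    ∃ l, c * 2 ^ l ≤ n ∧ n < 2 * c * 2 ^ l := by
  obtain ⟨l, h1, h2⟩ := exists_two_pow_le_lt (Nat.div_pos hn hc)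
  refine ⟨l, ?_, ?_⟩
  · rw [mul_comm]; exact (Nat.le_div_iff_mul_le hc).1 h1
  · rw [Nat.div_lt_iff_lt_mul hc] at h2; linarith

/-- The constant in the bound on the approximation error. -/
def errorConst : ℝ := 9 * (258 ^ 2 * 1108 ^ 2 * 20)

/-- `N` and `R` are the largest powers of two allowed by width `129N ≤ W` and depth `554R ≤ L`, and
`m` is the largest power of two up to `w`. Rounding to powers of two costs constants: `W < 258N`, `L
< 1108R` and `log W ≤ w + 9 ≤ 20m`, so `K` is of order `W²L² log W`. -/
theorem minimaxError_lipUnit_le {W L : ℕ} (hW : 554 ≤ W) (hL : 554 ≤ L) :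
    minimaxError lipUnit (quantizedRealizations 1 ⌈(L : ℝ) * Real.logb 2 W⌉₊ W L) ≤
      ENNReal.ofReal (errorConst * ((W : ℝ) ^ 2 * (L : ℝ) ^ 2 * Real.logb 2 W)⁻¹) := by
  obtain ⟨w, hw1, hw2⟩ := exists_two_pow_mul_le_lt (c := 129) (n := W) (by norm_num) (by omega)
  obtain ⟨l, hl1, hl2⟩ := exists_two_pow_mul_le_lt (c := 554) (n := L) (by norm_num) (by omega)
  have hw : 1 ≤ w := by
    rcases Nat.eq_zero_or_pos w with rfl | h
    · omega
    · exact h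
  obtain ⟨j, hj1, hj2⟩ := exists_two_pow_le_lt hw
  obtain ⟨N, hN⟩ : ∃ N, N = 2 ^ w := ⟨_, rfl⟩
  obtain ⟨R, hR⟩ : ∃ R, R = 2 ^ l := ⟨_, rfl⟩
  obtain ⟨m, hm⟩ : ∃ m, m = 2 ^ j := ⟨_, rfl⟩
  obtain ⟨K, hK⟩ : ∃ K, K = N * (N * (R * (m * R))) := ⟨_, rfl⟩
  rw [← hN] at hw1 hw2
  rw [← hR] at hl1 hl2
  rw [← hm] at hj1 hj2
  have hW0 : (0 : ℝ) < W := by exact_mod_cast (by omega : 0 < W)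
  have hL0 : (0 : ℝ) < L := by exact_mod_cast (by omega : 0 < L)
  have hlog1 : (w : ℝ) ≤ Real.logb 2 W := by
    rw [Real.le_logb_iff_rpow_le one_lt_two hW0, Real.rpow_natCast]
    have : 2 ^ w ≤ W := by omega
    exact_mod_cast this
  have hlog2 : Real.logb 2 W ≤ 20 * m := by
    have h1 : Real.logb 2 W ≤ (w + 9 : ℕ) := by
      rw [Real.logb_le_iff_le_rpow one_lt_two hW0, Real.rpow_natCast]
      have : W ≤ 2 ^ (w + 9) := by rw [pow_add, ← hN]; omega
      exact_mod_cast this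
    refine h1.trans ?_
    have : w + 9 ≤ 20 * m := by omega
    exact_mod_cast this
  have hw' : (1 : ℝ) ≤ w := by exact_mod_cast hw
  have hN0 : 0 < N := by rw [hN]; positivity
  have hR0 : 0 < R := by rw [hR]; positivity
  have hm0 : 0 < m := by rw [hm]; positivity
  have hb : 487 * R * w ≤ ⌈(L : ℝ) * Real.logb 2 W⌉₊ := by
    have h1 : ((487 * R * w : ℕ) : ℝ) ≤ (L : ℝ) * Real.logb 2 W := by
      push_cast
      have : ((487 * R : ℕ) : ℝ) ≤ L := by exact_mod_cast (by omega : 487 * R ≤ L)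
      push_cast at this
      exact mul_le_mul this hlog1 (by linarith) hL0.le
    exact_mod_cast h1.trans (Nat.le_ceil _)
  have hZ : (W : ℝ) ^ 2 * (L : ℝ) ^ 2 * Real.logb 2 W ≤ 258 ^ 2 * 1108 ^ 2 * 20 * K := by
    have h1 : (W : ℝ) ≤ 258 * N := by exact_mod_cast hw2.le
    have h2 : (L : ℝ) ≤ 1108 * R := by exact_mod_cast hl2.le
    calc _ ≤ (258 * (N : ℝ)) ^ 2 * (1108 * R) ^ 2 * (20 * m) := by gcongr; linarith
      _ = 258 ^ 2 * 1108 ^ 2 * 20 * K := by rw [hK]; push_cast; ring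
  have hZ0 : 0 < (W : ℝ) ^ 2 * (L : ℝ) ^ 2 * Real.logb 2 W := by
    have : 0 < Real.logb 2 W := by linarith
    positivity
  have hK0 : (0 : ℝ) < K := by
    have : 0 < K := by rw [hK]; positivity
    exact_mod_cast this
  have herr : 9 / (K : ℝ) ≤ errorConst * ((W : ℝ) ^ 2 * (L : ℝ) ^ 2 * Real.logb 2 W)⁻¹ := by
    rw [← div_eq_mul_inv, div_le_div_iff₀ hK0 hZ0, errorConst]
    linarith
  refine iSup₂_le fun f hf => ?_
  obtain ⟨-, hf1, hf2⟩ := hf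
  let F : ℝ → ℝ := Set.IccExtend (zero_le_one (α := ℝ)) f
  obtain ⟨Φ, h1, h2, h3, h4⟩ := exists_config_approx hN hR hm hj1 hK (F := F) (fun x => hf1 _)
    (fun x y => (hf2 _ _).trans (Set.abs_projIcc_sub_projIcc _))
  refine iInf₂_le_of_le Φ.toLInfty ⟨Φ, ⟨h2.trans hw1, h1.trans hl1,
    (h3.trans (unitGrid_mono hb)).trans (unitGrid_subset_quantized _)⟩, rfl⟩ ?_
  rw [edist_dist]
  refine ENNReal.ofReal_le_ofReal (le_trans ?_ herr)
  rw [dist_comm, dist_eq_norm]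
  refine lp.norm_le_of_forall_le (by positivity) fun x => ?_
  have := h4 x x.2.1 x.2.2
  rwa [show F x = f x from Set.IccExtend_val _ _ _] at this

theorem memoryRedundancy_lipUnit_le {W L : ℕ} (hW : 554 ≤ W) (hL : 554 ≤ L) :
    memoryRedundancy lipUnit (quantizedRealizations 1 ⌈(L : ℝ) * Real.logb 2 W⌉₊ W L) ≤
      ENNReal.ofReal (36 * errorConst) := by
  have herr := minimaxError_lipUnit_le hW hL
  have hC : 0 < errorConst := by norm_num [errorConst]
  generalize errorConst = C at herr hC ⊢
  have hW0 : (0 : ℝ) < W := by exact_mod_cast (by omega : 0 < W)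
  have hL0 : (0 : ℝ) < L := by exact_mod_cast (by omega : 0 < L)
  have hL1 : (1 : ℝ) ≤ L := by exact_mod_cast (by omega : 1 ≤ L)
  have hlog : 1 ≤ Real.logb 2 W := by
    rw [Real.le_logb_iff_rpow_le one_lt_two hW0, Real.rpow_one]
    exact_mod_cast (by omega : 2 ≤ W)
  have hLl : 1 ≤ (L : ℝ) * Real.logb 2 W := one_le_mul_of_one_le_of_one_le hL1 hlog
  set Z : ℝ := (W : ℝ) ^ 2 * (L : ℝ) ^ 2 * Real.logb 2 W with hZ
  have hZ0 : 0 < Z := by positivity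
  set b := ⌈(L : ℝ) * Real.logb 2 W⌉₊ with hb
  have hb1 : 1 ≤ b := Nat.ceil_pos.2 (by linarith)
  have hb2 : (b : ℝ) ≤ 2 * (L * Real.logb 2 W) := by
    have := Nat.ceil_lt_add_one (by linarith : 0 ≤ (L : ℝ) * Real.logb 2 W)
    linarith
  have hnum : ((⌈Real.logb 2 ((quantizedRealizations 1 b W L).ncard : ℝ)⌉₊ : ℕ) : ℝ) ≤ 18 * Z := by
    have h1 : ((⌈Real.logb 2 ((quantizedRealizations 1 b W L).ncard : ℝ)⌉₊ : ℕ) : ℝ) ≤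
        ((9 * W ^ 2 * L * b : ℕ) : ℝ) := by
      exact_mod_cast (quantizedRealizations_finite_and_log_le (L := L) hb1
        (by omega : 2 ≤ W)).2
    refine h1.trans ?_
    push_cast
    calc _ ≤ 9 * (W : ℝ) ^ 2 * L * (2 * (L * Real.logb 2 W)) := by gcongr
      _ = 18 * Z := by rw [hZ]; ring
  -- `n` is the largest integer strictly below `Z / (2C)`: strictness gives `2C/Z < 1/n`, and the `1
  -- +` in the redundancy makes up for the rounding, even when `n = 0`.
  obtain ⟨n, hn1, hn2⟩ : ∃ n : ℕ, Z / (2 * C) ≤ 1 + n ∧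
      (n : ℝ) < Z / (2 * C) := by
    have h0 : 0 < Z / (2 * C) := by positivity
    have h1 : 1 ≤ ⌈Z / (2 * C)⌉₊ := Nat.ceil_pos.2 h0
    refine ⟨⌈Z / (2 * C)⌉₊ - 1, ?_, ?_⟩
    · rw [Nat.cast_sub h1, Nat.cast_one, add_sub_cancel]
      exact Nat.le_ceil _
    · rw [Nat.cast_sub h1, Nat.cast_one]
      linarith [Nat.ceil_lt_add_one h0.le]
  have hcode : (n : ℕ∞) ≤
      minimaxCodeLength (minimaxError lipUnit (quantizedRealizations 1 b W L)) lipUnit := by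
    rcases Nat.eq_zero_or_pos n with rfl | hn
    · simp
    · have hn0 : (0 : ℝ) < n := by exact_mod_cast hn
      refine le_minimaxCodeLength herr (by positivity) ?_
      rw [lt_div_iff₀ (by positivity)] at hn2
      rw [lt_div_iff₀ hn0, ← mul_assoc, mul_assoc _ Z⁻¹, mul_comm Z⁻¹, ← mul_assoc,
        ← div_eq_mul_inv, div_lt_one hZ0]
      linarith
  refine ENNReal.div_le_of_le_mul ?_
  calc ((⌈Real.logb 2 ((quantizedRealizations 1 b W L).ncard : ℝ)⌉₊ : ℕ) : ℝ≥0∞)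
      = ENNReal.ofReal ((⌈Real.logb 2 ((quantizedRealizations 1 b W L).ncard : ℝ)⌉₊ : ℕ) : ℝ) :=
        (ENNReal.ofReal_natCast _).symm
    _ ≤ ENNReal.ofReal (36 * C * (1 + n : ℕ)) := by
        refine ENNReal.ofReal_le_ofReal (hnum.trans ?_)
        rw [div_le_iff₀ (by positivity)] at hn1
        push_cast
        linarith
    _ = ENNReal.ofReal (36 * C) * (1 + ((n : ℕ∞) : ℝ≥0∞)) := by
        rw [ENNReal.ofReal_mul (by positivity), ENNReal.ofReal_natCast]
        push_cast
        rfl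
    _ ≤ _ := by gcongr

theorem achievesMemoryOptimality_lipUnit :
    AchievesMemoryOptimality
      (ι := {p : ℕ × ℕ // (554 : ℝ) ≤ (p.1 : ℝ) ∧ (554 : ℝ) ≤ (p.2 : ℝ)}) lipUnit
      fun p => quantizedRealizations 1 ⌈(p.1.2 : ℝ) * Real.logb 2 (p.1.1 : ℝ)⌉₊ p.1.1 p.1.2 := by
  have hcast (p : {p : ℕ × ℕ // (554 : ℝ) ≤ (p.1 : ℝ) ∧ (554 : ℝ) ≤ (p.2 : ℝ)}) :
      554 ≤ p.1.1 ∧ 554 ≤ p.1.2 := ⟨by exact_mod_cast p.2.1, by exact_mod_cast p.2.2⟩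
  refine ⟨fun p => ?_, ?_, ?_⟩
  · obtain ⟨h1, h2⟩ := hcast p
    refine (quantizedRealizations_finite_and_log_le (Nat.ceil_pos.2 ?_) (by omega)).1
    have : 1 < (p.1.1 : ℝ) := by exact_mod_cast (by omega : 1 < p.1.1)
    have := Real.logb_pos one_lt_two this
    have : (0 : ℝ) < p.1.2 := by exact_mod_cast (by omega : 0 < p.1.2)
    positivity
  · refine le_antisymm ?_ bot_le
    have herr := @minimaxError_lipUnit_le
    have hC : 0 ≤ errorConst := by norm_num [errorConst]
    generalize errorConst = C at herr hC
    have hlim : Filter.Tendsto (fun W : ℕ => ENNReal.ofReal (C / W)) Filter.atTop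
        (nhds 0) := by
      simpa using ENNReal.tendsto_ofReal (tendsto_const_div_atTop_nhds_zero_nat C)
    refine ge_of_tendsto hlim (Filter.eventually_atTop.2 ⟨554, fun W hW => ?_⟩)
    have hW' : (554 : ℝ) ≤ W := by exact_mod_cast hW
    -- A fixed depth suffices: width alone drives the error to 0.
    obtain ⟨L, hL, hL'⟩ : ∃ L : ℕ, 554 ≤ L ∧ (554 : ℝ) ≤ L := ⟨554, le_rfl, by norm_num⟩
    refine (iInf_le _ ⟨(W, L), hW', hL'⟩).trans
      (le_trans (herr hW hL) (ENNReal.ofReal_le_ofReal ?_))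
    have hW1 : (1 : ℝ) ≤ W := by exact_mod_cast (by omega : 1 ≤ W)
    have hlog : 1 ≤ Real.logb 2 W := by
      rw [Real.le_logb_iff_rpow_le one_lt_two (by linarith), Real.rpow_one]
      exact_mod_cast (by omega : 2 ≤ W)
    rw [div_eq_mul_inv]
    refine mul_le_mul_of_nonneg_left (inv_anti₀ (by linarith) ?_) hC
    calc (W : ℝ) = W * 1 * 1 := by ring
      _ ≤ (W : ℝ) ^ 2 * (L : ℝ) ^ 2 * Real.logb 2 W := by
          gcongr
          · nlinarith
          · nlinarith
  · refine lt_of_le_of_lt (iSup_le fun p => ?_) (ENNReal.ofReal_lt_top (r := 36 * errorConst))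
    exact memoryRedundancy_lipUnit_le (hcast p).1 (hcast p).2

end ReLUNet
end

theorem mainTheorem8 :
    ∃ C₁ D₁ E₁ : ℝ, 0 < C₁ ∧ 2 ≤ D₁ ∧ 0 < E₁ ∧
      (∀ W L : ℕ, D₁ ≤ (W : ℝ) → D₁ ≤ (L : ℝ) →
        ReLUNet.minimaxError ReLUNet.lipUnit
            (ReLUNet.quantizedRealizations 1 ⌈E₁ * (L : ℝ) * Real.logb 2 (W : ℝ)⌉₊ W L) ≤
          ENNReal.ofReal
            (C₁ * ((W : ℝ) ^ 2 * (L : ℝ) ^ 2 * Real.logb 2 (W : ℝ))⁻¹)) ∧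
      ReLUNet.AchievesMemoryOptimality
        (ι := {p : ℕ × ℕ // D₁ ≤ (p.1 : ℝ) ∧ D₁ ≤ (p.2 : ℝ)})
        ReLUNet.lipUnit
        (fun p => ReLUNet.quantizedRealizations 1
          ⌈E₁ * (p.1.2 : ℝ) * Real.logb 2 (p.1.1 : ℝ)⌉₊ p.1.1 p.1.2) := by
  refine ⟨ReLUNet.errorConst, 554, 1, by norm_num [ReLUNet.errorConst], by norm_num, one_pos,
    fun W L hW hL => ?_, ?_⟩
  · rw [one_mul]
    exact ReLUNet.minimaxError_lipUnit_le (by exact_mod_cast hW) (by exact_mod_cast hL)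
  · simp only [one_mul]
    exact ReLUNet.achievesMemoryOptimality_lipUnit
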